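/- Let $V$ be a real vector space with symmetric algebra $S(V)=\bigoplus_{k\ge 0}S(V)_k$, and let $\mathcal S$ be a nonempty family of seminorms on $V$ that is directed: for all $\rho_1,\rho_2\in\mathcal S$ there are $\rho\in\mathcal S$ and $C>0$ with $\max\{\rho_1,\rho_2\}\le C\rho$. Let $\tau$ be the locally convex topology on $V$ generated by $\mathcal S$. For a seminorm $\rho$ on $V$, its projective extension $\overline\rho$ to $S(V)$ is defined by $\overline\rho(f)=\sum_k\overline\rho_k(f_k)$ for $f=\sum_k f_k$ with $f_k\in S(V)_k$, where $\overline\rho_0$ is the absolute value on $S(V)_0=\mathbb R$ and, for $k\ge1$, $$\overline\rho_k(g)=\inf\Big\{\sum_{i=1}^n\rho(g_{i1})\cdots\rho(g_{ik}) : g=\sum_{i=1}^n g_{i1}\cdots g_{ik},\ g_{ij}\in V,\ n\ge1\Big\}\qquad(g\in S(V)_k).$$ Let $\overline\tau$ be the topology on $S(V)$ generated by the seminorms $\overline{i\rho}$, $\rho\in\mathcal S$, $i\in\{1,2,3,\dots\}$. It is the finest locally multiplicatively convex topology (topology generated by a family of submultiplicative seminorms) on $S(V)$ which induces $\tau$ on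 $V$. Let $V^*=\operatorname{Hom}(V,\mathbb R)$ be the algebraic dual with the weak topology (the weakest one making all evaluations $v^*\mapsto v^*(f)$, $f\in V$, continuous). For $f\in S(V)$ let $\hat f:V^*\to\mathbb R$, $\hat f(v^*)=\overline{v^*}(f)$, where $\overline{v^*}:S(V)\to\mathbb R$ is the algebra homomorphism extending $v^*$. For a seminorm $\rho$ on $V$ and an integer $i\ge1$ put $\rho'(v^*)=\inf\{C\in[0,\infty):|v^*(w)|\le C\rho(w)\ \forall w\in V\}\in[0,\infty]$ and $\overline B_i(\rho')=\{v^*\in V^*:\rho'(v^*)\le i\}$. A positive Radon measure on $V^*$ is a Borel measure that is finite on compact sets and inner regular with respect to compact sets on all Borel sets; $\mu$ is supported by a Borel set $Y$ if $\mu(V^*\setminus Y)=0$. A $2d$-power module of $S(V)$ is a subset $M$ with $1\in M$, $M+M\subseteq M$ and $a^{2d}M\subseteq M$ for all $a\in S(V)$; $\sum S(V)^{2d}$ denotes the set of finite sums of $2d$-th powers. Then for each integer $d\ge1$, the relation $$L(f)=\int\hat f\,d\mu\quad\text{for all } f\in S(V)\qquad(\text{every }\hat f\text{ being }\mu\text{-integrable})$$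 is a one-to-one correspondence $L\leftrightarrow\mu$ between the $\overline\tau$-continuous linear functionals $L:S(V)\to\mathbb R$ with $L(\sum S(V)^{2d})\subseteq[0,\infty)$ and the positive Radon measures $\mu$ on $V^*$ that are supported by $\overline B_i(\rho')$ for some $\rho\in\mathcal S$ and some integer $i\ge1$. Moreover, whenever $L\leftrightarrow\mu$ under this correspondence, for all $\rho\in\mathcal S$ and all integers $i\ge1$: 1. $L$ is $\overline{i\rho}$-continuous if and only if $\mu$ is supported by $\overline B_i(\rho')$; 2. if $\mu$ is supported by $\overline B_i(\rho')$ and $M$ is any $2d$-power module of $S(V)$, then $L(M)\subseteq[0,\infty)$ if and only if $\mu$ is supported by $$X_M\cap\overline B_i(\rho'):=\{v^*\in\overline B_i(\rho') : \hat g(v^*)\ge0\ \ \forall g\in M\}.$$ -/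

import Mathlib

open MeasureTheory Topology
open scoped NNReal ENNReal

noncomputable section

namespace LMC

/-! ### Seminorms and locally (multiplicatively) convex topologies -/

section Seminorms

variable {E : Type*} [AddCommGroup E] [Module ℝ E]

/-- The locally convex (vector space) topology generated by a set of seminorms. -/
abbrev seminormTopology (P : Set (Seminorm ℝ E)) : TopologicalSpace E :=
  SeminormFamily.moduleFilterBasis
    ((fun p : P => (p : Seminorm ℝ E)) : SeminormFamily ℝ E P) |>.topology

/-- `Dominates p q` is the relation `p ⪰ q`: some positive multiple of `p` is at least `q`. -/
def Dominates (p q : Seminorm ℝ E) : Prop := ∃ C : ℝ, 0 < C ∧ ∀ v, q v ≤ C * p v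

/-- A directed (nonempty) set of seminorms. -/
def IsDirectedFamily (S : Set (Seminorm ℝ E)) : Prop :=
  S.Nonempty ∧ ∀ p ∈ S, ∀ q ∈ S, ∃ r ∈ S, Dominates r (p ⊔ q)

/-- A linear functional is continuous with respect to a seminorm. -/
def ContinuousFor (p : Seminorm ℝ E) (L : E →ₗ[ℝ] ℝ) : Prop :=
  ∃ C : ℝ, ∀ f, |L f| ≤ C * p f

end Seminorms

section Algebras

variable {A : Type*} [CommRing A] [Algebra ℝ A]

/-- A locally multiplicatively convex topology on an `ℝ`-algebra: one generated by some family of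
submultiplicative seminorms. -/
def IsLMC (σ : TopologicalSpace A) : Prop :=
  ∃ P : Set (Seminorm ℝ A), (∀ p ∈ P, ∀ a b, p (a * b) ≤ p a * p b) ∧ σ = seminormTopology P

/-- The set `∑ A^{2d}` of all finite sums of `2d`-th powers. -/
def sumsOfPowers (A : Type*) [CommRing A] (d : ℕ) : Set A :=
  (AddSubmonoid.closure (Set.range fun a : A => a ^ (2 * d)) : Set A)

/-- `2d`-power modules of `A`. -/
structure IsPowerModule (d : ℕ) (M : Set A) : Prop where
  one_mem : (1 : A) ∈ M
  add_mem : ∀ a ∈ M, ∀ b ∈ M, a + b ∈ M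
  pow_mul_mem : ∀ a : A, ∀ m ∈ M, a ^ (2 * d) * m ∈ M

/-- `L` takes nonnegative values on `M`. -/
def PositiveOn (L : A →ₗ[ℝ] ℝ) (M : Set A) : Prop := ∀ f ∈ M, 0 ≤ L f

end Algebras

/-! ### The symmetric algebra and the projective extension of a seminorm -/

variable (V : Type*) [AddCommGroup V] [Module ℝ V]

/-- The symmetric algebra `S(V)`. -/
abbrev Sym : Type _ := SymmetricAlgebra ℝ V

variable {V}

/-- The `k`-th homogeneous part `S(V)_k`: the span of the products of `k` vectors, which is the
image of the `k`-th tensor power of `V`. -/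
def homogeneousPart (V : Type*) [AddCommGroup V] [Module ℝ V] (k : ℕ) : Submodule ℝ (Sym V) :=
  Submodule.span ℝ (Set.range fun v : Fin k → V => ∏ j, SymmetricAlgebra.ι ℝ V (v j))

/-- The algebra homomorphism `S(V) → S(V)[X]` with `v ↦ v X` for `v ∈ V`. Its coefficients are the
homogeneous components, see `component_mem`, `sum_component` and `component_of_mem`. -/
def grading (V : Type*) [AddCommGroup V] [Module ℝ V] : Sym V →ₐ[ℝ] Polynomial (Sym V) :=
  SymmetricAlgebra.lift
    ((Polynomial.monomial 1 : Sym V →ₗ[Sym V] Polynomial (Sym V)).restrictScalars ℝ ∘ₗ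
      SymmetricAlgebra.ι ℝ V)

/-- The homogeneous component `f_k ∈ S(V)_k` of `f`. -/
def component (k : ℕ) (f : Sym V) : Sym V := (grading V f).coeff k

theorem grading_ι (v : V) :
    grading V (SymmetricAlgebra.ι ℝ V v) = Polynomial.monomial 1 (SymmetricAlgebra.ι ℝ V v) := by
  simp [grading]

theorem mul_mem_homogeneousPart {i j : ℕ} {f g : Sym V} (hf : f ∈ homogeneousPart V i)
    (hg : g ∈ homogeneousPart V j) : f * g ∈ homogeneousPart V (i + j) := by
  have h := Submodule.mul_mem_mul hf hg
  rw [homogeneousPart, homogeneousPart, Submodule.span_mul_span] at h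
  refine Submodule.span_mono ?_ h
  rintro _ ⟨_, ⟨v, rfl⟩, _, ⟨w, rfl⟩, rfl⟩
  refine ⟨Fin.append v w, ?_⟩
  simp [Fin.prod_univ_add]

theorem component_mem (k : ℕ) (f : Sym V) : component k f ∈ homogeneousPart V k := by
  induction f using SymmetricAlgebra.induction generalizing k with
  | algebraMap r =>
    rw [component, AlgHom.commutes, Polynomial.algebraMap_apply, Polynomial.coeff_C]
    split_ifs with h
    · subst h
      rw [Algebra.algebraMap_eq_smul_one]
      exact Submodule.smul_mem _ _ (Submodule.subset_span ⟨Fin.elim0, by simp⟩)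
    · exact Submodule.zero_mem _
  | ι v =>
    rw [component, grading_ι, Polynomial.coeff_monomial]
    split_ifs with h
    · subst h
      exact Submodule.subset_span ⟨fun _ => v, by simp⟩
    · exact Submodule.zero_mem _
  | mul a b ha hb =>
    rw [component, map_mul, Polynomial.coeff_mul]
    refine Submodule.sum_mem _ fun x hx => ?_
    rw [← Finset.HasAntidiagonal.mem_antidiagonal.1 hx]
    exact mul_mem_homogeneousPart (ha _) (hb _)
  | add a b ha hb =>
    rw [component, map_add, Polynomial.coeff_add]
    exact Submodule.add_mem _ (ha _) (hb _)

theorem eval_grading (f : Sym V) : (grading V f).eval 1 = f := by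
  induction f using SymmetricAlgebra.induction with
  | algebraMap r => rw [AlgHom.commutes, Polynomial.algebraMap_apply, Polynomial.eval_C]
  | ι v => rw [grading_ι]; simp
  | mul a b ha hb => rw [map_mul, Polynomial.eval_mul, ha, hb]
  | add a b ha hb => rw [map_add, Polynomial.eval_add, ha, hb]

/-- `f` is the sum of its homogeneous components. -/
theorem sum_component (f : Sym V) : ∑ k ∈ (grading V f).support, component k f = f := by
  conv_rhs => rw [← eval_grading f, Polynomial.eval_eq_sum, Polynomial.sum]
  simp [component]

/-- A homogeneous element is its own component. -/
theorem component_of_mem {k : ℕ} {f : Sym V} (hf : f ∈ homogeneousPart V k) (l : ℕ) :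
    component l f = if k = l then f else 0 := by
  have h : grading V f = Polynomial.monomial k f := by
    induction hf using Submodule.span_induction with
    | mem x hx =>
      obtain ⟨v, rfl⟩ := hx
      rw [map_prod]
      simp only [grading_ι]
      rw [← Polynomial.C_mul_X_pow_eq_monomial, map_prod]
      simp [← Polynomial.C_mul_X_pow_eq_monomial, Finset.prod_mul_distrib]
    | zero => simp
    | add x y _ _ hx hy => rw [map_add, map_add, hx, hy]
    | smul r x _ hx => rw [map_smul, hx, Polynomial.smul_monomial]
  rw [component, h, Polynomial.coeff_monomial]

/-- The numbers `∑ i, ρ(g i 1) ⋯ ρ(g i k)`, over all the ways to write `f` as a sum of products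
`∑ i, g i 1 ⋯ g i k` of `k` vectors. -/
def productCosts (ρ : Seminorm ℝ V) (k : ℕ) (f : Sym V) : Set ℝ :=
  {x | ∃ (n : ℕ) (g : Fin n → Fin k → V),
    f = ∑ i, ∏ j, SymmetricAlgebra.ι ℝ V (g i j) ∧ x = ∑ i, ∏ j, ρ (g i j)}

/-- The quotient seminorm `ρ̄_k` on `S(V)_k` of the `k`-th projective tensor power of `ρ`; for
`k = 0` it is the absolute value on `S(V)_0 = ℝ`. It is meant for arguments in `S(V)_k` only. -/
def degreeSeminorm (ρ : Seminorm ℝ V) : ℕ → Sym V → ℝ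
  | 0, f => |SymmetricAlgebra.algebraMapInv f|
  | k + 1, f => sInf (productCosts ρ (k + 1) f)

theorem productCosts_bddBelow (ρ : Seminorm ℝ V) (k : ℕ) (f : Sym V) :
    0 ∈ lowerBounds (productCosts ρ k f) := by
  rintro _ ⟨n, g, -, rfl⟩
  positivity

theorem productCosts_add {ρ : Seminorm ℝ V} {k : ℕ} {f g : Sym V} {x y : ℝ}
    (hx : x ∈ productCosts ρ k f) (hy : y ∈ productCosts ρ k g) :
    x + y ∈ productCosts ρ k (f + g) := by
  obtain ⟨n, u, rfl, rfl⟩ := hx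
  obtain ⟨m, w, rfl, rfl⟩ := hy
  exact ⟨n + m, Fin.append u w, by simp [Fin.sum_univ_add], by simp [Fin.sum_univ_add]⟩

theorem productCosts_smul {ρ : Seminorm ℝ V} {k : ℕ} {f : Sym V} {x : ℝ} (r : ℝ)
    (hx : x ∈ productCosts ρ (k + 1) f) : |r| * x ∈ productCosts ρ (k + 1) (r • f) := by
  obtain ⟨n, u, rfl, rfl⟩ := hx
  refine ⟨n, fun i => Fin.cons (r • u i 0) fun j => u i j.succ, ?_, ?_⟩
  · simp [Fin.prod_univ_succ, Finset.smul_sum]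
  · simp [Fin.prod_univ_succ, Finset.mul_sum, map_smul_eq_mul, mul_assoc]

theorem productCosts_nonempty (ρ : Seminorm ℝ V) {k : ℕ} {f : Sym V}
    (hf : f ∈ homogeneousPart V (k + 1)) : (productCosts ρ (k + 1) f).Nonempty := by
  induction hf using Submodule.span_induction with
  | mem x hx =>
    obtain ⟨v, rfl⟩ := hx
    exact ⟨_, 1, fun _ => v, by simp, rfl⟩
  | zero => exact ⟨_, 0, Fin.elim0, by simp, rfl⟩
  | add x y _ _ hx hy =>
    obtain ⟨a, ha⟩ := hx
    obtain ⟨b, hb⟩ := hy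
    exact ⟨_, productCosts_add ha hb⟩
  | smul r x _ hx =>
    obtain ⟨a, ha⟩ := hx
    exact ⟨_, productCosts_smul r ha⟩

theorem degreeSeminorm_nonneg (ρ : Seminorm ℝ V) (k : ℕ) (f : Sym V) :
    0 ≤ degreeSeminorm ρ k f := by
  cases k with
  | zero => exact abs_nonneg _
  | succ k => exact Real.sInf_nonneg fun x hx => productCosts_bddBelow ρ _ f hx

theorem degreeSeminorm_zero (ρ : Seminorm ℝ V) (k : ℕ) : degreeSeminorm ρ k 0 = 0 := by
  refine le_antisymm ?_ (degreeSeminorm_nonneg ρ k 0)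
  cases k with
  | zero => simp [degreeSeminorm]
  | succ k => exact csInf_le ⟨0, productCosts_bddBelow ρ _ _⟩ ⟨0, Fin.elim0, by simp, by simp⟩

theorem degreeSeminorm_add (ρ : Seminorm ℝ V) {k : ℕ} {f g : Sym V}
    (hf : f ∈ homogeneousPart V k) (hg : g ∈ homogeneousPart V k) :
    degreeSeminorm ρ k (f + g) ≤ degreeSeminorm ρ k f + degreeSeminorm ρ k g := by
  cases k with
  | zero => simpa [degreeSeminorm] using abs_add_le _ _
  | succ k =>
    have h : ∀ x ∈ productCosts ρ (k + 1) f, ∀ y ∈ productCosts ρ (k + 1) g,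
        degreeSeminorm ρ (k + 1) (f + g) ≤ x + y := fun x hx y hy =>
      csInf_le ⟨0, productCosts_bddBelow ρ _ _⟩ (productCosts_add hx hy)
    have h2 : ∀ x ∈ productCosts ρ (k + 1) f,
        degreeSeminorm ρ (k + 1) (f + g) - x ≤ degreeSeminorm ρ (k + 1) g := fun x hx =>
      le_csInf (productCosts_nonempty ρ hg) fun y hy => by linarith [h x hx y hy]
    have h3 : degreeSeminorm ρ (k + 1) (f + g) - degreeSeminorm ρ (k + 1) g ≤
        degreeSeminorm ρ (k + 1) f :=
      le_csInf (productCosts_nonempty ρ hf) fun x hx => by linarith [h2 x hx]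
    linarith

theorem degreeSeminorm_smul (ρ : Seminorm ℝ V) {k : ℕ} (r : ℝ) {f : Sym V}
    (hf : f ∈ homogeneousPart V k) :
    degreeSeminorm ρ k (r • f) ≤ |r| * degreeSeminorm ρ k f := by
  cases k with
  | zero => simp [degreeSeminorm, abs_mul]
  | succ k =>
    rcases eq_or_ne r 0 with rfl | hr
    · simp [degreeSeminorm_zero]
    · have hr' : 0 < |r| := abs_pos.2 hr
      rw [← div_le_iff₀' hr']
      refine le_csInf (productCosts_nonempty ρ hf) fun x hx => ?_
      rw [div_le_iff₀' hr']
      exact csInf_le ⟨0, productCosts_bddBelow ρ _ _⟩ (productCosts_smul r hx)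

/-- The value `∑ k, ρ̄_k(f_k)`. -/
def projectiveValue (ρ : Seminorm ℝ V) (f : Sym V) : ℝ :=
  ∑ k ∈ (grading V f).support, degreeSeminorm ρ k (component k f)

theorem projectiveValue_eq (ρ : Seminorm ℝ V) (f : Sym V) {s : Finset ℕ}
    (hs : (grading V f).support ⊆ s) :
    projectiveValue ρ f = ∑ k ∈ s, degreeSeminorm ρ k (component k f) := by
  refine Finset.sum_subset hs fun k _ hk => ?_
  rw [component, Polynomial.notMem_support_iff.1 hk, degreeSeminorm_zero]

/-- The projective extension `ρ̄` of `ρ` to `S(V)`, `ρ̄(f) = ∑ k, ρ̄_k(f_k)`. -/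
def projectiveExtension (ρ : Seminorm ℝ V) : Seminorm ℝ (Sym V) :=
  Seminorm.ofSMulLE (projectiveValue ρ) (by simp [projectiveValue])
    (fun f g => by
      rw [projectiveValue_eq ρ (f + g) (s := (grading V f).support ∪ (grading V g).support)
          (by rw [map_add]; exact Polynomial.support_add),
        projectiveValue_eq ρ f Finset.subset_union_left,
        projectiveValue_eq ρ g Finset.subset_union_right, ← Finset.sum_add_distrib]
      refine Finset.sum_le_sum fun k _ => ?_
      have h : component k (f + g) = component k f + component k g := by simp [component]
      rw [h]
      exact degreeSeminorm_add ρ (component_mem k f) (component_mem k g))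
    (fun r f => by
      rw [projectiveValue_eq ρ (r • f) (s := (grading V f).support)
          (by rw [map_smul]; exact Polynomial.support_smul r _), projectiveValue, Finset.mul_sum]
      refine Finset.sum_le_sum fun k _ => ?_
      have h : component k (r • f) = r • component k f := by simp [component]
      rw [h]
      exact degreeSeminorm_smul ρ r (component_mem k f))

/-- The topology `τ̄` on `S(V)`, generated by the seminorms `(i • ρ)‾` with `ρ ∈ S`, `i ≥ 1`, where
`S` is a directed family of seminorms that defines `τ`. -/
abbrev extensionTopology (S : Set (Seminorm ℝ V)) : TopologicalSpace (Sym V) :=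
  seminormTopology {p | ∃ ρ ∈ S, ∃ i : ℕ, 1 ≤ i ∧ p = projectiveExtension (i • ρ)}

/-- `σ` is the finest among the locally multiplicatively convex topologies on `S(V)` that extend
the topology `τ` of `V`. -/
def IsFinestLMCExtension (τ : TopologicalSpace V) (σ : TopologicalSpace (Sym V)) : Prop :=
  IsLMC σ ∧ TopologicalSpace.induced (SymmetricAlgebra.ι ℝ V) σ = τ ∧
    ∀ σ' : TopologicalSpace (Sym V), IsLMC σ' →
      TopologicalSpace.induced (SymmetricAlgebra.ι ℝ V) σ' = τ → σ ≤ σ'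

/-! ### The algebraic dual and measures on it -/

/-- The weak topology on the algebraic dual `V^*`: the weakest one for which every evaluation
`v^* ↦ v^*(f)` is continuous. -/
instance dualTopology : TopologicalSpace (Module.Dual ℝ V) :=
  TopologicalSpace.induced (fun (v : Module.Dual ℝ V) (f : V) => v f) Pi.topologicalSpace

instance dualMeasurableSpace : MeasurableSpace (Module.Dual ℝ V) := borel _

instance dualBorelSpace : BorelSpace (Module.Dual ℝ V) := ⟨rfl⟩

/-- The function `f̂` on `V^*`: its value at `v^*` is that of the character of `S(V)` extending
`v^*` at `f`. -/
def hat (f : Sym V) (v : Module.Dual ℝ V) : ℝ := SymmetricAlgebra.lift v f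

/-- The operator norm `ρ'` on `V^*`, with value `∞` on functionals that are not
`ρ`-continuous. -/
def dualNorm (ρ : Seminorm ℝ V) (v : Module.Dual ℝ V) : ℝ≥0∞ :=
  ⨅ (C : ℝ≥0) (_ : ∀ w, |v w| ≤ C * ρ w), (C : ℝ≥0∞)

/-- The closed ball `B̄_i(ρ')`. -/
def dualBall (ρ : Seminorm ℝ V) (i : ℕ) : Set (Module.Dual ℝ V) := {v | dualNorm ρ v ≤ i}

/-- The set `X_M ∩ B̄_i(ρ')`. -/
def positiveBall (M : Set (Sym V)) (ρ : Seminorm ℝ V) (i : ℕ) : Set (Module.Dual ℝ V) :=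
  {v | v ∈ dualBall ρ i ∧ ∀ g ∈ M, 0 ≤ hat g v}

/-- Positive Radon measures: Borel measures, finite on compact sets, with
`μ B = sup {μ K : K ⊆ B compact}` for every Borel set `B`. -/
structure IsRadon {X : Type*} [TopologicalSpace X] [MeasurableSpace X] (μ : Measure X) : Prop where
  finite_on_compacts : ∀ K, IsCompact K → μ K < ∞
  inner_regular : ∀ B, MeasurableSet B → μ B = ⨆ (K : Set X) (_ : K ⊆ B) (_ : IsCompact K), μ K

/-- `μ` is supported by `Y`. -/
def SupportedBy {X : Type*} [MeasurableSpace X] (μ : Measure X) (Y : Set X) : Prop := μ Yᶜ = 0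

/-- `L(f) = ∫ f̂ dμ` for all `f ∈ S(V)`, all these integrals being finite. -/
def Represents (μ : Measure (Module.Dual ℝ V)) (L : Sym V →ₗ[ℝ] ℝ) : Prop :=
  ∀ f, Integrable (hat f) μ ∧ L f = ∫ v, hat f v ∂μ

/-- The `τ̄`-continuous linear functionals that are nonnegative on `∑ S(V)^{2d}`. -/
def Functionals (S : Set (Seminorm ℝ V)) (d : ℕ) : Set (Sym V →ₗ[ℝ] ℝ) :=
  {L | Continuous[extensionTopology S, _] L ∧ PositiveOn L (sumsOfPowers (Sym V) d)}

/-- The positive Radon measures on `V^*` supported by a ball `B̄_i(ρ')`, `ρ ∈ S`, `i ≥ 1`. -/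
def Measures (S : Set (Seminorm ℝ V)) : Set (Measure (Module.Dual ℝ V)) :=
  {μ | IsRadon μ ∧ ∃ ρ ∈ S, ∃ i : ℕ, 1 ≤ i ∧ SupportedBy μ (dualBall ρ i)}

end LMC

end

/-! Everything rests on one estimate for a submultiplicative seminorm `q` on a commutative real
algebra and a `q`-continuous functional `L` that is nonnegative on `m`-th powers. If `q a < 1`, the
truncated binomial series of `(1 + X)^(1/m)`, evaluated at `a`, are approximate `m`-th roots of `1 +
a` whose errors tend to zero in `q`, so `L` is nonnegative on `(1 + a) * b ^ m`
(`nonneg_one_add_mul_pow`). No completion of the algebra is needed.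

This gives `|L a| ≤ L 1 * q a`, so the normalized functionals of this kind form a compact convex
set. It also splits each of them as a convex combination of normalized multiples by `1 + a` and `1 -
a`, so extreme points are multiplicative. By Krein–Milman, `L f ≥ 0` whenever `f` is nonnegative at
all `q`-bounded characters (`nonneg_of_forall_algHom`).

The projective extension of `i • ρ` is submultiplicative, and its bounded characters are the
evaluations at points of the ball `dualBall ρ i`, which is compact. Riesz extension and
Riesz–Markov–Kakutani then produce a measure on that ball (`exists_represents`). Stone–Weierstrass
gives uniqueness on a compact set, and directedness puts any two balls inside a third. Statement 1
follows from existence on the given ball together with uniqueness. For statement 2, density lets the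
negative part of `ĝ` be tested, and inner regularity handles uncountable modules.

That the topology is the finest one follows because the projective extension dominates every
submultiplicative seminorm whose restriction to `V` is at most `ρ`. -/

noncomputable section

namespace LMC

/-! ### The `ℓ¹`-norm on real polynomials and roots of `1 + a` -/

section CoeffNorm

open Polynomial

/-- The sum of the absolute values of the coefficients. -/
def coeffNorm (p : ℝ[X]) : ℝ := p.sum fun _ c => |c|

theorem coeffNorm_eq {p : ℝ[X]} {s : Finset ℕ} (hs : p.support ⊆ s) :
    coeffNorm p = ∑ k ∈ s, |p.coeff k| :=
  Polynomial.sum_eq_of_subset _ (by simp) hs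

theorem coeffNorm_nonneg (p : ℝ[X]) : 0 ≤ coeffNorm p :=
  Finset.sum_nonneg fun _ _ => abs_nonneg _

theorem coeffNorm_add_le (p r : ℝ[X]) : coeffNorm (p + r) ≤ coeffNorm p + coeffNorm r := by
  rw [coeffNorm_eq (p := p + r) (s := p.support ∪ r.support) Polynomial.support_add,
    coeffNorm_eq (p := p) Finset.subset_union_left,
    coeffNorm_eq (p := r) Finset.subset_union_right, ← Finset.sum_add_distrib]
  exact Finset.sum_le_sum fun k _ => by rw [coeff_add]; exact abs_add_le _ _

theorem coeffNorm_neg (p : ℝ[X]) : coeffNorm (-p) = coeffNorm p := by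
  simp [coeffNorm, Polynomial.sum_def]

theorem coeffNorm_monomial (n : ℕ) (c : ℝ) : coeffNorm (monomial n c) = |c| := by
  simp [coeffNorm, Polynomial.sum_monomial_index]

theorem coeffNorm_monomial_mul (n : ℕ) (c : ℝ) (p : ℝ[X]) :
    coeffNorm (monomial n c * p) = |c| * coeffNorm p := by
  have h : (monomial n c * p).support ⊆ p.support.map (addRightEmbedding n) := by
    intro k hk
    rw [Polynomial.mem_support_iff] at hk
    rw [Finset.mem_map]
    rcases le_or_gt n k with hn | hn
    · obtain ⟨j, rfl⟩ := Nat.exists_eq_add_of_le' hn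
      rw [coeff_monomial_mul] at hk
      exact ⟨j, Polynomial.mem_support_iff.2 (right_ne_zero_of_mul hk), rfl⟩
    · refine absurd ?_ hk
      rw [← C_mul_X_pow_eq_monomial, mul_assoc, coeff_C_mul, X_pow_mul, coeff_mul_X_pow',
        if_neg (by omega), mul_zero]
  rw [coeffNorm_eq h, Finset.sum_map, coeffNorm, Polynomial.sum_def, Finset.mul_sum]
  exact Finset.sum_congr rfl fun k _ => by
    rw [addRightEmbedding_apply, coeff_monomial_mul, abs_mul]

theorem coeffNorm_mul_le (p r : ℝ[X]) : coeffNorm (p * r) ≤ coeffNorm p * coeffNorm r := by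
  have h : ∀ s : Finset ℕ, coeffNorm ((∑ k ∈ s, monomial k (p.coeff k)) * r) ≤
      (∑ k ∈ s, |p.coeff k|) * coeffNorm r := by
    intro s
    induction s using Finset.induction_on with
    | empty => simp [coeffNorm]
    | insert a s ha ih =>
      rw [Finset.sum_insert ha, Finset.sum_insert ha, add_mul, add_mul]
      refine (coeffNorm_add_le _ _).trans (add_le_add ?_ ih)
      rw [coeffNorm_monomial_mul]
  have h2 := h p.support
  rwa [← Polynomial.as_sum_support] at h2

theorem coeffNorm_pow_le (p : ℝ[X]) (m : ℕ) : coeffNorm (p ^ m) ≤ coeffNorm p ^ m := by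
  induction m with
  | zero =>
    rw [pow_zero, pow_zero, ← monomial_zero_one, coeffNorm_monomial, abs_one]
  | succ m ih =>
    rw [pow_succ, pow_succ]
    exact (coeffNorm_mul_le _ _).trans
      (mul_le_mul_of_nonneg_right ih (coeffNorm_nonneg p))

/-- For `0 < x ≤ 1`, each factor of `x (x - 1) ⋯ (x - k + 1)` satisfies `|x - j| ≤ j + 1`, so the
product is at most `k!` in absolute value. -/
theorem abs_choose_inv_le_one {m : ℕ} (hm : m ≠ 0) (k : ℕ) :
    |Ring.choose ((m : ℝ)⁻¹) k| ≤ 1 := by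
  have h1 : (1 : ℝ) ≤ m := by exact_mod_cast Nat.one_le_iff_ne_zero.2 hm
  have h2 : (m : ℝ)⁻¹ ≤ 1 := inv_le_one_of_one_le₀ h1
  have h3 : 0 < (m : ℝ)⁻¹ := by positivity
  have key : ∀ k : ℕ, |(descPochhammer ℝ k).eval ((m : ℝ)⁻¹)| ≤ k.factorial := by
    intro k
    induction k with
    | zero => simp
    | succ k ih =>
      rw [descPochhammer_succ_right, eval_mul, abs_mul, Nat.factorial_succ, mul_comm (k + 1)]
      push_cast
      refine mul_le_mul ih ?_ (abs_nonneg _) (by positivity)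
      simp only [eval_sub, eval_X, eval_natCast]
      rw [abs_le]
      have : (0 : ℝ) ≤ k := by positivity
      constructor <;> linarith
  have h := Ring.descPochhammer_eq_factorial_smul_choose ((m : ℝ)⁻¹) k
  rw [nsmul_eq_mul] at h
  have hk := key k
  have h4 : (descPochhammer ℝ k).eval ((m : ℝ)⁻¹) =
      (descPochhammer ℤ k).smeval ((m : ℝ)⁻¹) := by
    rw [← descPochhammer_map (Int.castRingHom ℝ), Polynomial.eval_map,
      ← Polynomial.eval₂_smulOneHom_eq_smeval]
    congr 1
    ext x
    simp
  rw [h4, h, abs_mul, Nat.abs_cast] at hk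
  have h5 : (0 : ℝ) < k.factorial := by positivity
  exact le_of_mul_le_mul_left (by simpa using hk) h5

/-- The truncated binomial series of exponent `1 / m` are approximate `m`-th roots of `1 + X`. -/
theorem exists_approx_root {m : ℕ} (hm : m ≠ 0) (n : ℕ) :
    ∃ p r : ℝ[X], p ^ m - (1 + X) = X ^ n * r ∧ coeffNorm r ≤ (n : ℝ) ^ m + 2 := by
  set B : PowerSeries ℝ := PowerSeries.binomialSeries ℝ ((m : ℝ)⁻¹) with hB
  have hBm : B ^ m = 1 + PowerSeries.X := by
    have h : ∀ j : ℕ, B ^ j = PowerSeries.binomialSeries ℝ ((j : ℝ) * (m : ℝ)⁻¹) := by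
      intro j
      induction j with
      | zero => simp
      | succ j ih =>
        rw [pow_succ, ih, hB, ← PowerSeries.binomialSeries_add]
        congr 1
        push_cast
        ring
    rw [h, mul_inv_cancel₀ (Nat.cast_ne_zero.2 hm)]
    have h1 := PowerSeries.binomialSeries_nat (R := ℝ) (A := ℝ) 1
    rwa [Nat.cast_one, pow_one] at h1
  set p := PowerSeries.trunc n B with hp
  -- The truncation agrees with `B` modulo `X ^ n`, and `p - B` divides `p ^ m - B ^ m`.
  have hdvd : (PowerSeries.X : PowerSeries ℝ) ^ n ∣ (p : PowerSeries ℝ) ^ m - B ^ m := by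
    refine dvd_trans ?_ (sub_dvd_pow_sub_pow _ _ m)
    rw [PowerSeries.X_pow_dvd_iff]
    intro k hk
    rw [map_sub, Polynomial.coeff_coe, hp, PowerSeries.coeff_trunc, if_pos hk, sub_self]
  have hE : X ^ n ∣ p ^ m - (1 + X) := by
    rw [Polynomial.X_pow_dvd_iff]
    intro k hk
    rw [← Polynomial.coeff_coe]
    rw [hBm, PowerSeries.X_pow_dvd_iff] at hdvd
    simpa using hdvd k hk
  obtain ⟨r, hr⟩ := hE
  refine ⟨p, r, hr, ?_⟩
  -- Multiplication by `X ^ n` only shifts coefficients. The bound is then `n ^ m` from `p ^ m` plus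
  -- `2` from `1 + X`.
  have h1 : coeffNorm r = coeffNorm (p ^ m - (1 + X)) := by
    rw [hr, X_pow_eq_monomial, coeffNorm_monomial_mul, abs_one, one_mul]
  have h2 : coeffNorm p ≤ n := by
    have hs : p.support ⊆ Finset.range n := by
      intro k hk
      rw [Finset.mem_range]
      by_contra hkn
      rw [Polynomial.mem_support_iff, hp, PowerSeries.coeff_trunc, if_neg hkn] at hk
      exact hk rfl
    rw [coeffNorm_eq hs]
    calc ∑ k ∈ Finset.range n, |p.coeff k| ≤ ∑ k ∈ Finset.range n, (1 : ℝ) := by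
          refine Finset.sum_le_sum fun k hk => ?_
          rw [hp, PowerSeries.coeff_trunc, if_pos (Finset.mem_range.1 hk), hB,
            PowerSeries.binomialSeries_coeff, smul_eq_mul, mul_one]
          exact abs_choose_inv_le_one hm k
      _ = n := by simp
  have h3 : coeffNorm (1 + X : ℝ[X]) ≤ 2 := by
    refine (coeffNorm_add_le _ _).trans ?_
    rw [← monomial_zero_one, ← monomial_one_one_eq_X, coeffNorm_monomial, coeffNorm_monomial]
    norm_num
  rw [h1, sub_eq_add_neg]
  refine (coeffNorm_add_le _ _).trans ?_
  rw [coeffNorm_neg]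
  exact add_le_add ((coeffNorm_pow_le p m).trans
    (pow_le_pow_left₀ (coeffNorm_nonneg p) h2 m)) h3

end CoeffNorm

/-! ### Positive functionals for a submultiplicative seminorm -/

section Positive

variable {A : Type*} [CommRing A] [Algebra ℝ A] {q : Seminorm ℝ A}

theorem seminorm_pow_mul_le (hq : ∀ a b, q (a * b) ≤ q a * q b) (a x : A) (n : ℕ) :
    q (a ^ n * x) ≤ q a ^ n * q x := by
  induction n with
  | zero => simp
  | succ n ih =>
    rw [pow_succ', mul_assoc, pow_succ', mul_assoc]
    exact (hq _ _).trans (mul_le_mul_of_nonneg_left ih (apply_nonneg q a))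

/-- The factor `q 1` pays for the constant term, since `q 1 ≤ 1` is not assumed. -/
theorem seminorm_aeval_le (hq : ∀ a b, q (a * b) ≤ q a * q b) {a : A} (ha : q a ≤ 1)
    (p : Polynomial ℝ) : q (Polynomial.aeval a p) ≤ coeffNorm p * q 1 := by
  rw [Polynomial.aeval_eq_sum_range' (Nat.lt_succ_self _),
    coeffNorm_eq (s := Finset.range (p.natDegree + 1))
      (fun k hk => Finset.mem_range.2 (Nat.lt_succ_of_le (Polynomial.le_natDegree_of_mem_supp k hk))),
    Finset.sum_mul]
  have hsum : ∀ (s : Finset ℕ) (g : ℕ → A), q (∑ k ∈ s, g k) ≤ ∑ k ∈ s, q (g k) := fun s g =>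
    Finset.le_sum_of_subadditive q (map_zero q).le (map_add_le_add q) s g
  refine (hsum _ _).trans (Finset.sum_le_sum fun k _ => ?_)
  rw [map_smul_eq_mul, Real.norm_eq_abs]
  refine mul_le_mul_of_nonneg_left ?_ (abs_nonneg _)
  calc q (a ^ k) = q (a ^ k * 1) := by rw [mul_one]
    _ ≤ q a ^ k * q 1 := seminorm_pow_mul_le hq a 1 k
    _ ≤ 1 * q 1 := mul_le_mul_of_nonneg_right (pow_le_one₀ (apply_nonneg q a) ha)
        (apply_nonneg q 1)
    _ = q 1 := one_mul _

/-- A continuous functional that is nonnegative on `m`-th powers is nonnegative on their multiples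
by `1 + a` if `q a < 1`. -/
theorem nonneg_one_add_mul_pow (hq : ∀ a b, q (a * b) ≤ q a * q b) {m : ℕ} (hm : m ≠ 0)
    {L : A →ₗ[ℝ] ℝ} (hL : ContinuousFor q L) (hpos : ∀ b, 0 ≤ L (b ^ m)) {a : A} (ha : q a < 1)
    (b : A) : 0 ≤ L ((1 + a) * b ^ m) := by
  obtain ⟨C, hC⟩ := hL
  choose p r hpr hr using exists_approx_root hm
  have bound : ∀ n : ℕ, -(|C| * (q a ^ n * ((n : ℝ) ^ m + 2) * q 1 * q (b ^ m))) ≤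
      L ((1 + a) * b ^ m) := by
    intro n
    -- An exact `m`-th power, on which `L` is nonnegative, minus an error containing the factor `a ^
    -- n`.
    have e : (1 + a) * b ^ m =
        (Polynomial.aeval a (p n) * b) ^ m - a ^ n * Polynomial.aeval a (r n) * b ^ m := by
      have h := congrArg (Polynomial.aeval a) (hpr n)
      simp only [map_sub, map_pow, map_add, map_one, Polynomial.aeval_X, map_mul] at h
      rw [← h]
      ring
    have h1 : q (a ^ n * Polynomial.aeval a (r n) * b ^ m) ≤
        q a ^ n * ((n : ℝ) ^ m + 2) * q 1 * q (b ^ m) := by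
      refine (hq _ _).trans (mul_le_mul_of_nonneg_right ?_ (apply_nonneg q _))
      refine (seminorm_pow_mul_le hq _ _ _).trans ?_
      rw [mul_assoc]
      refine mul_le_mul_of_nonneg_left ?_ (pow_nonneg (apply_nonneg q a) n)
      exact (seminorm_aeval_le hq ha.le _).trans
        (mul_le_mul_of_nonneg_right (hr n) (apply_nonneg q 1))
    have h2 : |L (a ^ n * Polynomial.aeval a (r n) * b ^ m)| ≤
        |C| * (q a ^ n * ((n : ℝ) ^ m + 2) * q 1 * q (b ^ m)) :=
      (hC _).trans ((mul_le_mul_of_nonneg_right (le_abs_self C) (apply_nonneg q _)).trans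
        (mul_le_mul_of_nonneg_left h1 (abs_nonneg C)))
    rw [e, map_sub]
    have := hpos (Polynomial.aeval a (p n) * b)
    have := (abs_le.1 h2).2
    linarith
  have ha' : |q a| < 1 := by rwa [abs_of_nonneg (apply_nonneg q a)]
  have t1 := tendsto_pow_const_mul_const_pow_of_abs_lt_one m ha'
  have t2 := tendsto_pow_atTop_nhds_zero_of_abs_lt_one ha'
  -- The geometric decay of `q a ^ n` beats the polynomial growth of the remainder's coefficients.
  have t3 : Filter.Tendsto
      (fun n : ℕ => -(|C| * (q a ^ n * ((n : ℝ) ^ m + 2) * q 1 * q (b ^ m))))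
      Filter.atTop (𝓝 0) := by
    have h := ((t1.add (t2.const_mul 2)).mul_const (q 1 * q (b ^ m))).const_mul (-|C|)
    simp only [mul_zero, add_zero, zero_mul] at h
    refine h.congr fun n => ?_
    ring
  exact le_of_tendsto' t3 bound

/-- Apply the positivity of `L` at `1 ± a / c` for `c > q a`, and let `c` decrease to `q a`. An
arbitrary continuity constant thus improves to `L 1`. -/
theorem abs_le_of_nonneg_pow (hq : ∀ a b, q (a * b) ≤ q a * q b) {m : ℕ} (hm : m ≠ 0)
    {L : A →ₗ[ℝ] ℝ} (hL : ContinuousFor q L) (hpos : ∀ b, 0 ≤ L (b ^ m)) (a : A) :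
    |L a| ≤ L 1 * q a := by
  have h : ∀ c, q a < c → |L a| ≤ L 1 * c := by
    intro c hc
    have hc0 : 0 < c := (apply_nonneg q a).trans_lt hc
    have h1 : q (c⁻¹ • a) < 1 := by
      rw [map_smul_eq_mul, Real.norm_eq_abs, abs_of_pos (inv_pos.2 hc0), inv_mul_lt_iff₀ hc0,
        mul_one]
      exact hc
    have hp := nonneg_one_add_mul_pow hq hm hL hpos h1 1
    have hn := nonneg_one_add_mul_pow hq hm hL hpos (a := -(c⁻¹ • a)) (by rwa [map_neg_eq_map]) 1
    rw [one_pow, mul_one, map_add, map_smul, smul_eq_mul] at hp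
    rw [one_pow, mul_one, map_add, map_neg, map_smul, smul_eq_mul] at hn
    have e : c * (c⁻¹ * L a) = L a := mul_inv_cancel_left₀ hc0.ne' _
    have hp' := mul_nonneg hc0.le hp
    have hn' := mul_nonneg hc0.le hn
    rw [mul_add] at hp' hn'
    rw [mul_neg] at hn'
    rw [e] at hp' hn'
    rw [abs_le]
    constructor <;> linarith
  have t : Filter.Tendsto (fun c => L 1 * c) (𝓝[>] (q a)) (𝓝 (L 1 * q a)) :=
    (tendsto_nhdsWithin_of_tendsto_nhds Filter.tendsto_id).const_mul _
  exact ge_of_tendsto t (Filter.eventually_of_mem self_mem_nhdsWithin fun c hc => h c hc)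

/-- The normalized functionals that are bounded by `q` and nonnegative on `m`-th powers. -/
def states (q : Seminorm ℝ A) (m : ℕ) : Set (A → ℝ) :=
  {φ | ∃ L : A →ₗ[ℝ] ℝ, ⇑L = φ ∧ L 1 = 1 ∧ (∀ a, |L a| ≤ q a) ∧ ∀ b, 0 ≤ L (b ^ m)}

/-- A closed subset of a product of compact intervals, since every defining condition is closed
under pointwise limits. -/
theorem isCompact_states (q : Seminorm ℝ A) (m : ℕ) : IsCompact (states q m) := by
  have e : states q m = (Set.univ.pi fun a => Set.Icc (-q a) (q a)) ∩
      (Set.range ((↑) : (A →ₗ[ℝ] ℝ) → A → ℝ) ∩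
        ({φ | φ 1 = 1} ∩ ⋂ b : A, {φ | 0 ≤ φ (b ^ m)})) := by
    ext φ
    simp only [states, Set.mem_ofPred_eq, Set.mem_inter_iff, Set.mem_pi, Set.mem_univ,
      forall_true_left, Set.mem_Icc, Set.mem_range, Set.mem_iInter, ← abs_le]
    constructor
    · rintro ⟨L, rfl, h1, h2, h3⟩
      exact ⟨h2, ⟨L, rfl⟩, h1, h3⟩
    · rintro ⟨h2, ⟨L, rfl⟩, h1, h3⟩
      exact ⟨L, rfl, h1, h2, h3⟩
  rw [e]
  refine (isCompact_univ_pi fun a => isCompact_Icc).inter_right ?_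
  refine (LinearMap.isClosed_range_coe A ℝ (RingHom.id ℝ)).inter
    ((isClosed_eq (continuous_apply _) continuous_const).inter
      (isClosed_iInter fun b => isClosed_le continuous_const (continuous_apply _)))

theorem convex_states (q : Seminorm ℝ A) (m : ℕ) : Convex ℝ (states q m) := by
  rintro _ ⟨L, rfl, h1, h2, h3⟩ _ ⟨L', rfl, h1', h2', h3'⟩ s t hs ht hst
  refine ⟨s • L + t • L', by ext; simp, by simp [h1, h1', hst], fun a => ?_, fun b => ?_⟩
  · simp only [LinearMap.add_apply, LinearMap.smul_apply, smul_eq_mul]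
    calc |s * L a + t * L' a| ≤ |s * L a| + |t * L' a| := abs_add_le _ _
      _ = s * |L a| + t * |L' a| := by rw [abs_mul, abs_mul, abs_of_nonneg hs, abs_of_nonneg ht]
      _ ≤ s * q a + t * q a := add_le_add (mul_le_mul_of_nonneg_left (h2 a) hs)
          (mul_le_mul_of_nonneg_left (h2' a) ht)
      _ = q a := by rw [← add_mul, hst, one_mul]
  · simp only [LinearMap.add_apply, LinearMap.smul_apply, smul_eq_mul]
    exact add_nonneg (mul_nonneg hs (h3 b)) (mul_nonneg ht (h3' b))

/-- Here `1 + L a > 0` because `|L a| ≤ q a < 1`. Submultiplicativity gives only a crude continuity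
constant; `abs_le_of_nonneg_pow` and the normalization sharpen it to `1`. -/
theorem mul_left_mem_states (hq : ∀ a b, q (a * b) ≤ q a * q b) {m : ℕ} (hm : m ≠ 0)
    {L : A →ₗ[ℝ] ℝ} (hL : ⇑L ∈ states q m) {a : A} (ha : q a < 1) :
    ⇑((1 + L a)⁻¹ • L ∘ₗ LinearMap.mulLeft ℝ (1 + a)) ∈ states q m := by
  obtain ⟨L', hL', h1, h2, h3⟩ := hL
  obtain rfl : L' = L := DFunLike.coe_injective hL'
  have hs : 0 < 1 + L' a := by linarith [(abs_le.1 (h2 a)).1]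
  set N := (1 + L' a)⁻¹ • L' ∘ₗ LinearMap.mulLeft ℝ (1 + a) with hN
  have hNa : ∀ x, N x = (1 + L' a)⁻¹ * L' ((1 + a) * x) := fun x => rfl
  have hN1 : N 1 = 1 := by
    rw [hNa, mul_one, map_add, h1, inv_mul_cancel₀ hs.ne']
  have hNp : ∀ b, 0 ≤ N (b ^ m) := fun b => by
    rw [hNa]
    exact mul_nonneg (inv_nonneg.2 hs.le)
      (nonneg_one_add_mul_pow hq hm ⟨1, by simpa using h2⟩ h3 ha b)
  have hNc : ContinuousFor q N := by
    refine ⟨(1 + L' a)⁻¹ * q (1 + a), fun x => ?_⟩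
    rw [hNa, abs_mul, abs_of_pos (inv_pos.2 hs), mul_assoc]
    exact mul_le_mul_of_nonneg_left ((h2 _).trans (hq _ _)) (inv_nonneg.2 hs.le)
  refine ⟨N, rfl, hN1, fun x => ?_, hNp⟩
  simpa [hN1] using abs_le_of_nonneg_pow hq hm hNc hNp x

/-- The extreme states are characters. -/
theorem exists_algHom_of_mem_extremePoints (hq : ∀ a b, q (a * b) ≤ q a * q b) {m : ℕ}
    (hm : m ≠ 0) {φ : A → ℝ} (hφ : φ ∈ (states q m).extremePoints ℝ) :
    ∃ χ : A →ₐ[ℝ] ℝ, ⇑χ = φ ∧ ∀ a, |χ a| ≤ q a := by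
  obtain ⟨⟨L, rfl, h1, h2, h3⟩, hext⟩ := mem_extremePoints.1 hφ
  have hmem : ⇑L ∈ states q m := ⟨L, rfl, h1, h2, h3⟩
  have small : ∀ a x, q a < 1 → L (a * x) = L a * L x := by
    intro a x ha
    have hs : 0 < 1 + L a := by linarith [(abs_le.1 (h2 a)).1]
    have ht : 0 < 1 - L a := by linarith [(abs_le.1 (h2 a)).2]
    have m1 := mul_left_mem_states hq hm hmem ha
    have m2 := mul_left_mem_states hq hm hmem (a := -a) (by rwa [map_neg_eq_map])
    -- With these weights the normalizing factors cancel and the combination is `L`. Extremality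
    -- equates `L` with the first endpoint, which is multiplicativity at `a`.
    have seg := (hext _ m1 _ m2 ⟨(1 + L a) / 2, (1 - L a) / 2, by positivity, by positivity,
      by ring, ?_⟩).1
    · have := congrFun seg x
      simp only [LinearMap.smul_apply, LinearMap.comp_apply, LinearMap.mulLeft_apply,
        smul_eq_mul, inv_mul_eq_iff_eq_mul₀ hs.ne', add_mul, one_mul, map_add] at this
      linarith
    · ext y
      simp only [Pi.add_apply, Pi.smul_apply, LinearMap.smul_apply, LinearMap.comp_apply,
        LinearMap.mulLeft_apply, smul_eq_mul, map_neg, ← sub_eq_add_neg]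
      have e1 : (1 + L a) / 2 * ((1 + L a)⁻¹ * L ((1 + a) * y)) = L ((1 + a) * y) / 2 := by
        field_simp
      have e2 : (1 - L a) / 2 * ((1 - L a)⁻¹ * L ((1 - a) * y)) = L ((1 - a) * y) / 2 := by
        field_simp
      rw [e1, e2, add_mul, sub_mul, map_add, map_sub, one_mul]
      ring
  have hmul : ∀ a x, L (a * x) = L a * L x := by
    intro a x
    have hc : 0 < q a + 1 := by linarith [apply_nonneg q a]
    have h := small ((q a + 1)⁻¹ • a) x (by
      rw [map_smul_eq_mul, Real.norm_eq_abs, abs_of_pos (inv_pos.2 hc), inv_mul_lt_iff₀ hc]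
      linarith)
    rw [smul_mul_assoc, map_smul, map_smul, smul_mul_assoc] at h
    exact smul_right_injective ℝ (inv_ne_zero hc.ne') h
  exact ⟨AlgHom.ofLinearMap L h1 hmul, rfl, h2⟩

/-- A continuous functional that is nonnegative on `m`-th powers is nonnegative at every element
at which all bounded characters are. -/
theorem nonneg_of_forall_algHom (hq : ∀ a b, q (a * b) ≤ q a * q b) {m : ℕ} (hm : m ≠ 0)
    {L : A →ₗ[ℝ] ℝ} (hL : ContinuousFor q L) (hpos : ∀ b, 0 ≤ L (b ^ m)) {f : A}
    (hf : ∀ χ : A →ₐ[ℝ] ℝ, (∀ a, |χ a| ≤ q a) → 0 ≤ χ f) : 0 ≤ L f := by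
  have hb := abs_le_of_nonneg_pow hq hm hL hpos
  have hL1 : 0 ≤ L 1 := by simpa using hpos 1
  rcases hL1.eq_or_lt with h0 | h0
  · have := hb f
    rw [← h0, zero_mul] at this
    rw [abs_nonpos_iff.1 this]
  have hmem : ⇑((L 1)⁻¹ • L) ∈ states q m := by
    refine ⟨_, rfl, by simp [h0.ne'], fun a => ?_, fun b => ?_⟩
    · rw [LinearMap.smul_apply, smul_eq_mul, abs_mul, abs_of_pos (inv_pos.2 h0),
        inv_mul_le_iff₀ h0]
      exact hb a
    · exact mul_nonneg (inv_nonneg.2 h0.le) (hpos b)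
  -- Krein–Milman: a closed convex condition need only be checked at extreme points, which are
  -- bounded characters.
  have hsub : states q m ⊆ {φ | 0 ≤ φ f} := by
    rw [← closure_convexHull_extremePoints (isCompact_states q m) (convex_states q m)]
    refine closure_minimal (convexHull_min ?_ ?_)
      (isClosed_le continuous_const (continuous_apply f))
    · intro φ hφ
      obtain ⟨χ, rfl, hχ⟩ := exists_algHom_of_mem_extremePoints hq hm hφ
      exact hf χ hχ
    · intro φ hφ ψ hψ s t hs ht _
      exact add_nonneg (mul_nonneg hs hφ) (mul_nonneg ht hψ)
  have := hsub hmem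
  have h2 : 0 ≤ (L 1)⁻¹ * L f := this
  exact nonneg_of_mul_nonneg_right h2 (inv_pos.2 h0)

end Positive

/-! ### The projective extension is the largest seminorm with its values on products -/

section Extension

variable {V : Type*} [AddCommGroup V] [Module ℝ V]

theorem nsmul_seminorm_apply (ρ : Seminorm ℝ V) (i : ℕ) (v : V) : (i • ρ) v = i * ρ v := by
  rw [← nsmul_eq_mul]
  rfl

theorem projectiveExtension_of_mem (ρ : Seminorm ℝ V) {k : ℕ} {f : Sym V}
    (hf : f ∈ homogeneousPart V k) : projectiveExtension ρ f = degreeSeminorm ρ k f := by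
  have hs : (grading V f).support ⊆ {k} := by
    intro l hl
    rw [Polynomial.mem_support_iff] at hl
    by_contra hlk
    refine hl ((component_of_mem hf l).trans (if_neg ?_))
    rintro rfl
    exact hlk (Finset.mem_singleton_self _)
  change projectiveValue ρ f = _
  rw [projectiveValue_eq ρ f hs, Finset.sum_singleton, component_of_mem hf, if_pos rfl]

theorem prod_mem_homogeneousPart {k : ℕ} (v : Fin k → V) :
    ∏ j, SymmetricAlgebra.ι ℝ V (v j) ∈ homogeneousPart V k :=
  Submodule.subset_span ⟨v, rfl⟩

theorem projectiveExtension_prod_le (ρ : Seminorm ℝ V) {k : ℕ} (v : Fin k → V) :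
    projectiveExtension ρ (∏ j, SymmetricAlgebra.ι ℝ V (v j)) ≤ ∏ j, ρ (v j) := by
  rw [projectiveExtension_of_mem ρ (prod_mem_homogeneousPart v)]
  cases k with
  | zero => simp [degreeSeminorm]
  | succ k =>
    exact csInf_le ⟨0, productCosts_bddBelow ρ _ _⟩ ⟨1, fun _ => v, by simp, by simp⟩

/-- Subadditivity bounds `p f` by `C` times the cost of any representation. In degree `0` the
hypothesis says `p 1 ≤ C`, and the scalars are the multiples of `1`. -/
theorem le_degreeSeminorm {ρ : Seminorm ℝ V} {p : Seminorm ℝ (Sym V)} {C : ℝ} (hC : 0 ≤ C)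
    {k : ℕ} (h : ∀ v : Fin k → V, p (∏ j, SymmetricAlgebra.ι ℝ V (v j)) ≤ C * ∏ j, ρ (v j))
    {f : Sym V} (hf : f ∈ homogeneousPart V k) : p f ≤ C * degreeSeminorm ρ k f := by
  cases k with
  | zero =>
    have hf' : f ∈ Submodule.span ℝ {(1 : Sym V)} := by
      refine Submodule.span_mono ?_ hf
      rintro _ ⟨v, rfl⟩
      simp
    obtain ⟨r, rfl⟩ := Submodule.mem_span_singleton.1 hf'
    have h1 := h Fin.elim0
    simp only [Finset.univ_eq_empty, Finset.prod_empty, mul_one] at h1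
    simp only [map_smul_eq_mul, degreeSeminorm, map_smul, map_one, smul_eq_mul, mul_one,
      Real.norm_eq_abs]
    rw [mul_comm C]
    exact mul_le_mul_of_nonneg_left h1 (abs_nonneg r)
  | succ k =>
    have h1 : ∀ x ∈ productCosts ρ (k + 1) f, p f ≤ C * x := by
      rintro _ ⟨n, g, rfl, rfl⟩
      rw [Finset.mul_sum]
      exact (Finset.le_sum_of_subadditive p (map_zero p).le (map_add_le_add p) _ _).trans
        (Finset.sum_le_sum fun i _ => h (g i))
    rcases hC.eq_or_lt with rfl | hC
    · obtain ⟨x, hx⟩ := productCosts_nonempty ρ hf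
      simpa using h1 x hx
    · rw [← div_le_iff₀' hC]
      exact le_csInf (productCosts_nonempty ρ hf) fun x hx => (div_le_iff₀' hC).2 (h1 x hx)

/-- The projective extension dominates the seminorms that it dominates on products of vectors. -/
theorem le_projectiveExtension {ρ : Seminorm ℝ V} {p : Seminorm ℝ (Sym V)} {C : ℝ} (hC : 0 ≤ C)
    (h : ∀ (k : ℕ) (v : Fin k → V),
      p (∏ j, SymmetricAlgebra.ι ℝ V (v j)) ≤ C * ∏ j, ρ (v j)) (f : Sym V) :
    p f ≤ C * projectiveExtension ρ f := by
  change p f ≤ C * projectiveValue ρ f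
  rw [projectiveValue, Finset.mul_sum]
  conv_lhs => rw [← sum_component f]
  exact (Finset.le_sum_of_subadditive p (map_zero p).le (map_add_le_add p) _ _).trans
    (Finset.sum_le_sum fun k _ => le_degreeSeminorm hC (h k) (component_mem k f))

/-- Maximality is used twice: for multiplication by a fixed product of vectors, then for
multiplication by a fixed `g`. -/
theorem projectiveExtension_mul_le (ρ : Seminorm ℝ V) (f g : Sym V) :
    projectiveExtension ρ (f * g) ≤ projectiveExtension ρ f * projectiveExtension ρ g := by
  have h1 : ∀ (k : ℕ) (v : Fin k → V),
      projectiveExtension ρ ((∏ j, SymmetricAlgebra.ι ℝ V (v j)) * g) ≤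
        (∏ j, ρ (v j)) * projectiveExtension ρ g := by
    intro k v
    have h := le_projectiveExtension (ρ := ρ) (C := ∏ j, ρ (v j))
      (p := (projectiveExtension ρ).comp
        (LinearMap.mulLeft ℝ (∏ j, SymmetricAlgebra.ι ℝ V (v j))))
      (Finset.prod_nonneg fun j _ => apply_nonneg ρ _) (fun l w => ?_) g
    · rwa [Seminorm.comp_apply, LinearMap.mulLeft_apply] at h
    · have h := projectiveExtension_prod_le ρ (Fin.append v w)
      rw [Seminorm.comp_apply, LinearMap.mulLeft_apply]
      simpa only [Fin.prod_univ_add, Fin.append_left, Fin.append_right] using h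
  have h2 := le_projectiveExtension (ρ := ρ) (C := projectiveExtension ρ g)
    (p := (projectiveExtension ρ).comp (LinearMap.mulRight ℝ g))
    (apply_nonneg _ g) (fun k v => ?_) f
  · rwa [Seminorm.comp_apply, LinearMap.mulRight_apply, mul_comm (projectiveExtension ρ g)] at h2
  · rw [Seminorm.comp_apply, LinearMap.mulRight_apply, mul_comm (projectiveExtension ρ g)]
    exact h1 k v

/-- Linear functionals separate the points of `V`, and each extends to `S(V)`. -/
theorem ι_injective : Function.Injective (SymmetricAlgebra.ι ℝ V) := by
  rw [injective_iff_map_eq_zero]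
  intro v hv
  rw [← Module.forall_dual_apply_eq_zero_iff ℝ v]
  intro φ
  rw [← SymmetricAlgebra.lift_ι_apply φ v, hv, map_zero]

/-- In degree one, injectivity of `ι` turns a representation into `v = ∑ i, g i 0`, so the lower
bound is the triangle inequality for `ρ`. -/
theorem projectiveExtension_ι (ρ : Seminorm ℝ V) (v : V) :
    projectiveExtension ρ (SymmetricAlgebra.ι ℝ V v) = ρ v := by
  have h1 := projectiveExtension_prod_le ρ fun _ : Fin 1 => v
  simp only [Fin.prod_univ_one] at h1
  refine le_antisymm h1 ?_
  have hm := prod_mem_homogeneousPart fun _ : Fin 1 => v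
  simp only [Fin.prod_univ_one] at hm
  rw [projectiveExtension_of_mem ρ hm]
  refine le_csInf (productCosts_nonempty ρ hm) ?_
  rintro _ ⟨n, g, hg, rfl⟩
  replace hg : SymmetricAlgebra.ι ℝ V v = SymmetricAlgebra.ι ℝ V (∑ i, g i 0) := by
    rw [map_sum]
    exact hg.trans (Finset.sum_congr rfl fun i _ => Fin.prod_univ_one _)
  rw [ι_injective hg]
  exact (Finset.le_sum_of_subadditive ρ (map_zero ρ).le (map_add_le_add ρ) _ _).trans_eq
    (Finset.sum_congr rfl fun i _ => (Fin.prod_univ_one fun j => ρ (g i j)).symm)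

theorem projectiveExtension_mono {ρ ρ' : Seminorm ℝ V} (h : ∀ v, ρ v ≤ ρ' v) (f : Sym V) :
    projectiveExtension ρ f ≤ projectiveExtension ρ' f := by
  have := le_projectiveExtension (ρ := ρ') (p := projectiveExtension ρ) zero_le_one
    (fun k v => by
      rw [one_mul]
      exact (projectiveExtension_prod_le ρ v).trans
        (Finset.prod_le_prod (fun j _ => apply_nonneg ρ _) fun j _ => h _)) f
  rwa [one_mul] at this

/-- A submultiplicative seminorm is dominated by the projective extension of any seminorm that is
at least its restriction to `V`. -/
theorem dominates_of_submultiplicative {ρ : Seminorm ℝ V} {p : Seminorm ℝ (Sym V)}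
    (hp : ∀ a b, p (a * b) ≤ p a * p b) (h : ∀ v, p (SymmetricAlgebra.ι ℝ V v) ≤ ρ v) :
    Dominates (projectiveExtension (V := V) ρ) p := by
  -- The factor `p 1` covers the empty product; adding `1` makes the constant strictly positive.
  have hC : 0 < p 1 + 1 := by linarith [apply_nonneg p 1]
  refine ⟨p 1 + 1, hC, le_projectiveExtension hC.le fun k v => ?_⟩
  have key : p (∏ j, SymmetricAlgebra.ι ℝ V (v j)) ≤ p 1 * ∏ j, ρ (v j) := by
    induction k with
    | zero => simp
    | succ k ih =>
      rw [Fin.prod_univ_succ, Fin.prod_univ_succ, mul_left_comm]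
      exact (hp _ _).trans (mul_le_mul (h _) (ih _) (apply_nonneg p _) (apply_nonneg ρ _))
  refine key.trans (mul_le_mul_of_nonneg_right (by linarith) ?_)
  exact Finset.prod_nonneg fun j _ => apply_nonneg ρ _

end Extension

/-! ### Topologies generated by directed families of seminorms -/

section Topologies

variable {E : Type*} [AddCommGroup E] [Module ℝ E]

theorem withSeminorms_seminormTopology (P : Set (Seminorm ℝ E)) :
    letI := seminormTopology P
    WithSeminorms (fun p : P => (p : Seminorm ℝ E)) :=
  let _ := seminormTopology P
  ⟨rfl⟩

theorem Dominates.trans {p q r : Seminorm ℝ E} (h : Dominates p q) (h' : Dominates q r) :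
    Dominates p r := by
  obtain ⟨C, hC, h⟩ := h
  obtain ⟨D, hD, h'⟩ := h'
  refine ⟨D * C, mul_pos hD hC, fun v => (h' v).trans ?_⟩
  rw [mul_assoc]
  exact mul_le_mul_of_nonneg_left (h v) hD.le

theorem dominates_of_le {p q : Seminorm ℝ E} (h : q ≤ p) : Dominates p q :=
  ⟨1, one_pos, fun v => by rw [one_mul]; exact h v⟩

/-- Directedness replaces the finite suprema in continuity criteria by a single member of the
family. -/
theorem IsDirectedFamily.exists_dominates_finset_sup {P : Set (Seminorm ℝ E)}
    (hP : IsDirectedFamily P) (s : Finset P) :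
    ∃ r ∈ P, Dominates r (s.sup fun p : P => (p : Seminorm ℝ E)) := by
  classical
  induction s using Finset.induction_on with
  | empty =>
    obtain ⟨r, hr⟩ := hP.1
    exact ⟨r, hr, dominates_of_le bot_le⟩
  | insert a s _ ih =>
    obtain ⟨r, hr, h⟩ := ih
    obtain ⟨t, ht, h'⟩ := hP.2 a a.2 r hr
    obtain ⟨C, hC, h⟩ := h
    refine ⟨t, ht, h'.trans ⟨max 1 C, lt_max_of_lt_left one_pos, fun v => ?_⟩⟩
    have hm : 0 ≤ ((a : Seminorm ℝ E) ⊔ r) v := apply_nonneg _ v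
    rw [Finset.sup_insert, Seminorm.sup_apply, sup_le_iff]
    have h1 : (a : Seminorm ℝ E) v ≤ ((a : Seminorm ℝ E) ⊔ r) v :=
      (le_sup_left : (a : Seminorm ℝ E) ≤ (a : Seminorm ℝ E) ⊔ r) v
    have h2 : r v ≤ ((a : Seminorm ℝ E) ⊔ r) v :=
      (le_sup_right : r ≤ (a : Seminorm ℝ E) ⊔ r) v
    constructor
    · refine h1.trans ?_
      calc _ = 1 * ((a : Seminorm ℝ E) ⊔ r) v := (one_mul _).symm
        _ ≤ _ := mul_le_mul_of_nonneg_right (le_max_left _ _) hm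
    · exact (h v).trans ((mul_le_mul_of_nonneg_left h2 hC.le).trans
        (mul_le_mul_of_nonneg_right (le_max_right _ _) hm))

theorem IsDirectedFamily.exists_dominates {P : Set (Seminorm ℝ E)} (hP : IsDirectedFamily P)
    {p : Seminorm ℝ E} (hp : Continuous[seminormTopology P, _] p) : ∃ r ∈ P, Dominates r p := by
  let _ := seminormTopology P
  obtain ⟨s, C, hC, h⟩ :=
    Seminorm.bound_of_continuous (withSeminorms_seminormTopology P) p hp
  obtain ⟨r, hr, hd⟩ := hP.exists_dominates_finset_sup s
  exact ⟨r, hr, hd.trans ⟨C, NNReal.coe_pos.2 (pos_iff_ne_zero.2 hC), fun v => h v⟩⟩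

theorem Dominates.bound {P : Set (Seminorm ℝ E)} {r p : Seminorm ℝ E} (hr : r ∈ P)
    (h : Dominates r p) :
    ∃ s : Finset P, ∃ C : ℝ≥0, p ≤ C • s.sup fun p : P => (p : Seminorm ℝ E) := by
  obtain ⟨C, hC, h⟩ := h
  refine ⟨{⟨r, hr⟩}, ⟨C, hC.le⟩, fun v => ?_⟩
  rw [Finset.sup_singleton]
  exact h v

theorem continuous_of_continuousFor {P : Set (Seminorm ℝ E)} {p : Seminorm ℝ E} (hp : p ∈ P)
    {L : E →ₗ[ℝ] ℝ} (hL : ContinuousFor p L) : Continuous[seminormTopology P, _] L := by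
  let _ := seminormTopology P
  obtain ⟨C, hC⟩ := hL
  refine WithSeminorms.continuous_real_rng (withSeminorms_seminormTopology P) L
    ⟨{⟨p, hp⟩}, ‖C‖₊, fun x => ?_⟩
  rw [Finset.sup_singleton]
  exact (le_abs_self _).trans ((hC x).trans
    (mul_le_mul_of_nonneg_right (le_abs_self C) (apply_nonneg p x)))

theorem IsDirectedFamily.exists_continuousFor {P : Set (Seminorm ℝ E)} (hP : IsDirectedFamily P)
    {L : E →ₗ[ℝ] ℝ} (hL : Continuous[seminormTopology P, _] L) : ∃ p ∈ P, ContinuousFor p L := by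
  let _ := seminormTopology P
  obtain ⟨p, hp, C, -, h⟩ := hP.exists_dominates (p := (normSeminorm ℝ ℝ).comp L)
    (continuous_norm.comp hL)
  exact ⟨p, hp, C, h⟩

end Topologies

/-! ### The topology generated by the projective extensions -/

section ExtensionTopology

variable {V : Type*} [AddCommGroup V] [Module ℝ V]

/-- The seminorms that define `extensionTopology`. -/
def extensionFamily (S : Set (Seminorm ℝ V)) : Set (Seminorm ℝ (Sym V)) :=
  {p | ∃ ρ ∈ S, ∃ i : ℕ, 1 ≤ i ∧ p = projectiveExtension (i • ρ)}

/-- The constant must be absorbed into the multiple of `ρ` before extending, because scaling `ρ` by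
`j` scales the degree `k` part of its extension by `j ^ k`. -/
theorem nsmul_le_nsmul_of_dominates {ρ ρ' : Seminorm ℝ V} (h : Dominates ρ ρ') (i : ℕ) :
    ∃ j : ℕ, 1 ≤ j ∧ ∀ v, (i • ρ') v ≤ (j • ρ) v := by
  obtain ⟨C, hC, h⟩ := h
  refine ⟨max 1 ⌈i * C⌉₊, le_max_left _ _, fun v => ?_⟩
  rw [nsmul_seminorm_apply, nsmul_seminorm_apply]
  calc (i : ℝ) * ρ' v ≤ i * (C * ρ v) := mul_le_mul_of_nonneg_left (h v) (Nat.cast_nonneg i)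
    _ = (i * C) * ρ v := (mul_assoc _ _ _).symm
    _ ≤ _ := mul_le_mul_of_nonneg_right
        ((Nat.le_ceil _).trans (Nat.cast_le.2 (le_max_right _ _))) (apply_nonneg ρ v)

/-- Two balls are contained in a common one. -/
theorem IsDirectedFamily.exists_nsmul_le {S : Set (Seminorm ℝ V)} (hS : IsDirectedFamily S)
    {ρ ρ' : Seminorm ℝ V} (hρ : ρ ∈ S) (hρ' : ρ' ∈ S) (i j : ℕ) :
    ∃ r ∈ S, ∃ k : ℕ, 1 ≤ k ∧ (∀ v, (i • ρ) v ≤ (k • r) v) ∧ ∀ v, (j • ρ') v ≤ (k • r) v := by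
  obtain ⟨r, hr, hd⟩ := hS.2 ρ hρ ρ' hρ'
  obtain ⟨k, hk, h⟩ := nsmul_le_nsmul_of_dominates (hd.trans (dominates_of_le le_sup_left)) i
  obtain ⟨l, -, h'⟩ := nsmul_le_nsmul_of_dominates (hd.trans (dominates_of_le le_sup_right)) j
  have aux : ∀ a b : ℕ, a ≤ b → ∀ v, (a • r) v ≤ (b • r) v := fun a b hab v => by
    rw [nsmul_seminorm_apply, nsmul_seminorm_apply]
    exact mul_le_mul_of_nonneg_right (Nat.cast_le.2 hab) (apply_nonneg r v)
  exact ⟨r, hr, max k l, hk.trans (le_max_left _ _),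
    fun v => (h v).trans (aux _ _ (le_max_left _ _) v),
    fun v => (h' v).trans (aux _ _ (le_max_right _ _) v)⟩

theorem IsDirectedFamily.extensionFamily {S : Set (Seminorm ℝ V)} (hS : IsDirectedFamily S) :
    IsDirectedFamily (LMC.extensionFamily (V := V) S) := by
  refine ⟨?_, ?_⟩
  · obtain ⟨ρ, hρ⟩ := hS.1
    exact ⟨_, ρ, hρ, 1, le_rfl, rfl⟩
  · rintro _ ⟨ρ, hρ, i, -, rfl⟩ _ ⟨ρ', hρ', j, -, rfl⟩
    obtain ⟨r, hr, k, hk, h, h'⟩ := hS.exists_nsmul_le hρ hρ' i j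
    exact ⟨_, ⟨r, hr, k, hk, rfl⟩, dominates_of_le (sup_le (projectiveExtension_mono h)
      (projectiveExtension_mono h'))⟩

theorem induced_extensionTopology (S : Set (Seminorm ℝ V)) :
    TopologicalSpace.induced (SymmetricAlgebra.ι ℝ V) (extensionTopology S) =
      seminormTopology S := by
  let _ := seminormTopology (extensionFamily (V := V) S)
  have h1 := LinearMap.withSeminorms_induced
    (withSeminorms_seminormTopology (extensionFamily (V := V) S)) (SymmetricAlgebra.ι ℝ V)
  let _ := TopologicalSpace.induced (SymmetricAlgebra.ι ℝ V) (seminormTopology (extensionFamily (V := V) S))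
  have h2 : WithSeminorms (fun p : S => (p : Seminorm ℝ V)) := by
    refine h1.congr ?_ ?_
    · rintro ⟨ρ, hρ⟩
      refine ⟨{⟨_, ρ, hρ, 1, le_rfl, rfl⟩}, 1, fun v => ?_⟩
      rw [Finset.sup_singleton, one_smul]
      change ρ v ≤ projectiveExtension (1 • ρ) (SymmetricAlgebra.ι ℝ V v)
      rw [projectiveExtension_ι, nsmul_seminorm_apply, Nat.cast_one, one_mul]
    · rintro ⟨_, ρ, hρ, i, hi, rfl⟩
      refine Dominates.bound hρ ⟨i, Nat.cast_pos.2 hi, fun v => ?_⟩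
      change projectiveExtension (i • ρ) (SymmetricAlgebra.ι ℝ V v) ≤ _
      rw [projectiveExtension_ι, nsmul_seminorm_apply]
  exact h2.topology_eq_withSeminorms

theorem isFinestLMCExtension_extensionTopology {S : Set (Seminorm ℝ V)}
    (hS : IsDirectedFamily S) :
    IsFinestLMCExtension (seminormTopology S) (extensionTopology S) := by
  refine ⟨⟨_, ?_, rfl⟩, induced_extensionTopology S, ?_⟩
  · rintro _ ⟨ρ, -, i, -, rfl⟩ a b
    exact projectiveExtension_mul_le _ a b
  · rintro _ ⟨P, hP, rfl⟩ hind
    rw [← continuous_id_iff_le]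
    refine WithSeminorms.continuous_of_isBounded
      (withSeminorms_seminormTopology (extensionFamily (V := V) S)) (withSeminorms_seminormTopology P)
      LinearMap.id ?_
    rintro ⟨p, hp⟩
    have hc : Continuous[seminormTopology S, _] (p.comp (SymmetricAlgebra.ι ℝ V)) := by
      let _ := seminormTopology P
      have h1 : Continuous p := (withSeminorms_seminormTopology P).continuous_seminorm ⟨p, hp⟩
      rw [← hind]
      let _ := TopologicalSpace.induced (SymmetricAlgebra.ι ℝ V) (seminormTopology P)
      exact h1.comp continuous_induced_dom
    obtain ⟨ρ, hρ, hd⟩ := hS.exists_dominates hc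
    obtain ⟨j, hj, h⟩ := nsmul_le_nsmul_of_dominates hd 1
    refine Dominates.bound ⟨ρ, hρ, j, hj, rfl⟩
      (dominates_of_submultiplicative (hP p hp) fun v => ?_)
    have := h v
    rwa [nsmul_seminorm_apply, Nat.cast_one, one_mul] at this

end ExtensionTopology

/-! ### Radon measures with compact support -/

section Radon

variable {X : Type*} [MeasurableSpace X]

theorem SupportedBy.mono {μ : Measure X} {Y Z : Set X} (h : SupportedBy μ Y) (hYZ : Y ⊆ Z) :
    SupportedBy μ Z :=
  measure_mono_null (Set.compl_subset_compl.2 hYZ) h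

theorem supportedBy_map_val {K : Set X} (hK : MeasurableSet K) (ν : Measure K) :
    SupportedBy (ν.map Subtype.val) K := by
  rw [SupportedBy, (MeasurableEmbedding.subtype_coe hK).map_apply]
  simp

variable [TopologicalSpace X] [BorelSpace X]

/-- A compact subset of the union is locally null, hence null. Inner regularity passes this to the
union, with no countability of `I`. -/
theorem IsRadon.measure_iUnion_eq_zero {μ : Measure X} (hμ : IsRadon μ) {I : Type*}
    {U : I → Set X} (hU : ∀ i, IsOpen (U i)) (h0 : ∀ i, μ (U i) = 0) : μ (⋃ i, U i) = 0 := by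
  rw [hμ.inner_regular _ (isOpen_iUnion hU).measurableSet, ← nonpos_iff_eq_zero]
  refine iSup_le fun C => iSup_le fun hCU => iSup_le fun hC => le_of_eq ?_
  refine hC.measure_zero_of_nhdsWithin fun x hx => ?_
  obtain ⟨i, hi⟩ := Set.mem_iUnion.1 (hCU hx)
  exact ⟨U i, mem_nhdsWithin_of_mem_nhds ((hU i).mem_nhds hi), h0 i⟩

variable [T2Space X] {K : Set X}

theorem isRadon_map_val (hK : IsCompact K) (ν : Measure K) [IsFiniteMeasure ν] [ν.Regular] :
    IsRadon (ν.map Subtype.val) := by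
  have he := MeasurableEmbedding.subtype_coe hK.measurableSet
  refine ⟨fun C _ => measure_lt_top _ _, fun B hB => le_antisymm ?_ ?_⟩
  · rw [he.map_apply, (he.measurable hB).measure_eq_iSup_isCompact_of_ne_top (measure_ne_top _ _)]
    refine iSup_le fun C => iSup_le fun hCB => iSup_le fun hC => ?_
    refine le_trans ?_ (le_iSup_of_le (Subtype.val '' C) (le_iSup_of_le (Set.image_subset_iff.2 hCB)
      (le_iSup_of_le (hC.image continuous_subtype_val) le_rfl)))
    rw [he.map_apply]
    exact measure_mono (Set.subset_preimage_image _ _)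
  · exact iSup_le fun C => iSup_le fun hCB => iSup_le fun _ => measure_mono hCB

/-- A Radon measure supported by a compact set comes from a regular measure on that set. -/
theorem IsRadon.exists_eq_map_val {μ : Measure X} (hμ : IsRadon μ) (hK : IsCompact K)
    (hs : SupportedBy μ K) :
    ∃ ν : Measure K, IsFiniteMeasure ν ∧ ν.Regular ∧ μ = ν.map Subtype.val := by
  have he := MeasurableEmbedding.subtype_coe hK.measurableSet
  have : CompactSpace K := isCompact_iff_compactSpace.1 hK
  have hfin : IsFiniteMeasure (μ.comap (Subtype.val : K → X)) := by
    refine ⟨?_⟩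
    rw [he.comap_apply]
    exact (measure_mono (by simp)).trans_lt (hμ.finite_on_compacts K hK)
  have hreg : (μ.comap (Subtype.val : K → X)).InnerRegular := by
    refine ⟨fun U hU r hr => ?_⟩
    rw [he.comap_apply, hμ.inner_regular _ (he.measurableSet_image.2 hU)] at hr
    simp only [lt_iSup_iff] at hr
    obtain ⟨C, hCU, hC, hrC⟩ := hr
    have himg : Subtype.val '' ((Subtype.val : K → X) ⁻¹' C) = C := by
      rw [Subtype.image_preimage_coe]
      refine Set.inter_eq_right.2 fun x hx => ?_
      obtain ⟨y, -, rfl⟩ := hCU hx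
      exact y.2
    refine ⟨Subtype.val ⁻¹' C, ?_, ?_, ?_⟩
    · rw [← Set.preimage_image_eq U Subtype.val_injective]
      exact Set.preimage_mono hCU
    · exact (hC.isClosed.preimage continuous_subtype_val).isCompact
    · rwa [he.comap_apply, himg]
  refine ⟨μ.comap Subtype.val, hfin, inferInstance, ?_⟩
  rw [he.map_comap, Subtype.range_coe, eq_comm]
  exact Measure.restrict_eq_self_of_ae_mem (show ∀ᵐ x ∂μ, x ∈ K from hs)

theorem IsRadon.integrable {μ : Measure X} (hμ : IsRadon μ) (hK : IsCompact K)
    (hs : SupportedBy μ K) {F : X → ℝ} (hF : Continuous F) : Integrable F μ := by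
  obtain ⟨ν, _, _, rfl⟩ := hμ.exists_eq_map_val hK hs
  have : CompactSpace K := isCompact_iff_compactSpace.1 hK
  rw [(MeasurableEmbedding.subtype_coe hK.measurableSet).integrable_map_iff]
  exact (hF.comp continuous_subtype_val).integrable_of_hasCompactSupport
    (HasCompactSupport.of_compactSpace _)

end Radon

/-! ### Integration of continuous functions on a compact space -/

section CompactSpace

variable {X : Type*} [TopologicalSpace X] [CompactSpace X] [MeasurableSpace X] [BorelSpace X]

theorem integrable_continuousMap (ν : Measure X) [IsFiniteMeasure ν] (F : C(X, ℝ)) :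
    Integrable F ν :=
  F.continuous.integrable_of_hasCompactSupport (HasCompactSupport.of_compactSpace _)

theorem continuous_integral_continuousMap (ν : Measure X) [IsFiniteMeasure ν] :
    Continuous fun F : C(X, ℝ) => ∫ x, F x ∂ν := by
  refine LipschitzWith.continuous (K := (ν.real Set.univ).toNNReal)
    (LipschitzWith.of_dist_le_mul fun F G => ?_)
  rw [dist_eq_norm, ← integral_sub (integrable_continuousMap ν F) (integrable_continuousMap ν G),
    Real.coe_toNNReal _ measureReal_nonneg, mul_comm]
  refine norm_integral_le_of_norm_le_const (Filter.Eventually.of_forall fun x => ?_)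
  rw [← dist_eq_norm]
  exact ContinuousMap.dist_apply_le_dist x

/-- If `F ^ m * G` has nonnegative integral for a dense set of functions `F`, then `0 ≤ G` almost
everywhere. -/
theorem measure_neg_eq_zero_of_dense (ν : Measure X) [IsFiniteMeasure ν] {m : ℕ} (hm : m ≠ 0)
    {D : Set C(X, ℝ)} (hD : Dense D) (G : C(X, ℝ)) (h : ∀ F ∈ D, 0 ≤ ∫ x, (F ^ m * G) x ∂ν) :
    ν {x | G x < 0} = 0 := by
  have hall : ∀ F : C(X, ℝ), 0 ≤ ∫ x, (F ^ m * G) x ∂ν := by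
    have hc : IsClosed {F : C(X, ℝ) | 0 ≤ ∫ x, (F ^ m * G) x ∂ν} :=
      isClosed_le continuous_const ((continuous_integral_continuousMap ν).comp
        ((continuous_pow m).mul continuous_const))
    intro F
    exact hc.closure_subset_iff.2 h (hD F)
  -- Test with the `m`-th root `F` of the negative part `ψ` of `G`: then `F ^ m * G = -ψ ^ 2`, which
  -- forces `ψ = 0` almost everywhere.
  let ψ : C(X, ℝ) := ⟨fun x => max (-G x) 0, by fun_prop⟩
  have hψ : ∀ x, 0 ≤ ψ x := fun x => le_max_right _ _
  let F : C(X, ℝ) := ⟨fun x => ψ x ^ ((m : ℝ)⁻¹),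
    ψ.continuous.rpow_const fun _ => Or.inr (by positivity)⟩
  have hF : ∀ x, (F ^ m * G) x = -(ψ x ^ 2) := by
    intro x
    have h1 : F x ^ m = ψ x := Real.rpow_inv_natCast_pow (hψ x) hm
    rw [ContinuousMap.mul_apply, ContinuousMap.pow_apply, h1]
    change max (-G x) 0 * G x = -(max (-G x) 0) ^ 2
    rcases le_total (G x) 0 with hx | hx
    · rw [max_eq_left (by linarith)]
      ring
    · rw [max_eq_right (by linarith)]
      simp
  have h1 := hall F
  simp only [hF, integral_neg] at h1
  have h2 : ∫ x, (ψ ^ 2) x ∂ν = 0 :=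
    le_antisymm (by simpa using h1) (integral_nonneg fun x => sq_nonneg (ψ x))
  have h3 : 0 ≤ ⇑(ψ ^ 2) := fun x => sq_nonneg (ψ x)
  rw [integral_eq_zero_iff_of_nonneg h3 (integrable_continuousMap ν _)] at h2
  refine measure_mono_null (fun x hx => ?_) (ae_iff.1 h2)
  have hx' : G x < 0 := hx
  have hpos : 0 < ψ x := lt_max_of_lt_left (by linarith)
  exact (pow_pos hpos 2).ne'

variable [T2Space X]

/-- A functional on a space of continuous functions that contains `1` and is nonnegative on
nonnegative functions is represented by a regular measure. -/
theorem exists_measure_of_nonneg {W : Type*} [AddCommGroup W] [Module ℝ W] (T : W →ₗ[ℝ] C(X, ℝ))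
    (w₁ : W) (hw₁ : T w₁ = 1) (L : W →ₗ[ℝ] ℝ) (hL : ∀ w, (∀ x, 0 ≤ T w x) → 0 ≤ L w) :
    ∃ ν : Measure X, IsFiniteMeasure ν ∧ ν.Regular ∧ ∀ w, L w = ∫ x, T w x ∂ν := by
  -- If `T w = 0`, positivity applies to both `w` and `-w`. So `L` descends to the range of `T`.
  have hker : LinearMap.ker T ≤ LinearMap.ker L := by
    intro w hw
    rw [LinearMap.mem_ker] at hw ⊢
    refine le_antisymm ?_ (hL w fun x => by simp [hw])
    have := hL (-w) fun x => by simp [hw]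
    rw [map_neg] at this
    linarith
  let f : C(X, ℝ) →ₗ.[ℝ] ℝ :=
    ⟨LinearMap.range T, ((LinearMap.ker T).liftQ L hker) ∘ₗ T.quotKerEquivRange.symm.toLinearMap⟩
  have hf : ∀ w, f ⟨T w, LinearMap.mem_range_self T w⟩ = L w := by
    intro w
    change ((LinearMap.ker T).liftQ L hker) (T.quotKerEquivRange.symm _) = _
    rw [LinearMap.quotKerEquivRange_symm_apply_image, Submodule.mkQ_apply, Submodule.liftQ_apply]
  obtain ⟨g, hg, hpos⟩ := riesz_extension (PointedCone.positive ℝ C(X, ℝ)) f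
    (by
      rintro ⟨_, w, rfl⟩ hw
      rw [hf]
      rw [PointedCone.mem_positive] at hw
      exact hL w fun x => hw x)
    (by
      -- The cofinality condition of the Riesz extension theorem: `‖F‖ • 1 + F` is nonnegative.
      intro F
      refine ⟨⟨T (‖F‖ • w₁), LinearMap.mem_range_self T _⟩, ?_⟩
      rw [PointedCone.mem_positive]
      intro x
      have h1 := (abs_le.1 (F.norm_coe_le_norm x)).1
      simp only [map_smul, hw₁]
      change 0 ≤ ‖F‖ * 1 + F x
      linarith)
  let Λ : CompactlySupportedContinuousMap X ℝ →ₚ[ℝ] ℝ :=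
    PositiveLinearMap.mk₀
      { toFun := fun F => g F.toContinuousMap
        map_add' := fun F G => g.map_add F.toContinuousMap G.toContinuousMap
        map_smul' := fun r F => g.map_smul r F.toContinuousMap }
      (fun F hF => hpos _ ((PointedCone.mem_positive _ _).2 fun x => hF x))
  refine ⟨RealRMK.rieszMeasure Λ, inferInstance, inferInstance, fun w => ?_⟩
  have h1 := RealRMK.integral_rieszMeasure Λ ⟨T w, HasCompactSupport.of_compactSpace _⟩
  rw [← hf w, ← hg]
  exact h1.symm

theorem measure_eq_of_dense {ν ν' : Measure X} [IsFiniteMeasure ν] [IsFiniteMeasure ν']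
    [ν.Regular] [ν'.Regular] {D : Set C(X, ℝ)} (hD : Dense D)
    (h : ∀ F ∈ D, ∫ x, F x ∂ν = ∫ x, F x ∂ν') : ν = ν' := by
  refine Measure.ext_of_integral_eq_on_compactlySupported fun F => ?_
  have hc : IsClosed {F : C(X, ℝ) | ∫ x, F x ∂ν = ∫ x, F x ∂ν'} :=
    isClosed_eq (continuous_integral_continuousMap ν) (continuous_integral_continuousMap ν')
  exact hc.closure_subset_iff.2 h (hD F.toContinuousMap)

end CompactSpace

/-! ### The algebraic dual -/

section Dual

variable {V : Type*} [AddCommGroup V] [Module ℝ V]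

theorem continuous_dual_apply (w : V) : Continuous fun v : Module.Dual ℝ V => v w :=
  (continuous_apply w).comp continuous_induced_dom

theorem isEmbedding_dual : IsEmbedding fun (v : Module.Dual ℝ V) (w : V) => v w :=
  ⟨⟨rfl⟩, DFunLike.coe_injective⟩

instance t2Space_dual : T2Space (Module.Dual ℝ V) := isEmbedding_dual.t2Space

/-- The infimum defining the dual norm is attained: the bounds hold for all `c > i`, and `c` can
decrease to `i`. -/
theorem mem_dualBall {ρ : Seminorm ℝ V} {i : ℕ} {v : Module.Dual ℝ V} :
    v ∈ dualBall ρ i ↔ ∀ w, |v w| ≤ (i • ρ) w := by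
  simp only [nsmul_seminorm_apply]
  constructor
  · intro hv w
    have h : ∀ c : ℝ, (i : ℝ) < c → |v w| ≤ c * ρ w := by
      intro c hc
      have hc0 : 0 ≤ c := (Nat.cast_nonneg i).trans hc.le
      have h1 : dualNorm ρ v < ENNReal.ofReal c := by
        refine lt_of_le_of_lt (show dualNorm ρ v ≤ i from hv) ?_
        rw [← ENNReal.ofReal_natCast]
        exact (ENNReal.ofReal_lt_ofReal_iff_of_nonneg (Nat.cast_nonneg i)).2 hc
      simp only [dualNorm, iInf_lt_iff] at h1
      obtain ⟨C, hC, hCc⟩ := h1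
      have h2 : (C : ℝ) ≤ c := by
        rw [← ENNReal.ofReal_coe_nnreal] at hCc
        exact ((ENNReal.ofReal_lt_ofReal_iff_of_nonneg C.2).1 hCc).le
      exact (hC w).trans (mul_le_mul_of_nonneg_right h2 (apply_nonneg ρ w))
    have t : Filter.Tendsto (fun c => c * ρ w) (𝓝[>] (i : ℝ)) (𝓝 (i * ρ w)) :=
      (tendsto_nhdsWithin_of_tendsto_nhds Filter.tendsto_id).mul_const _
    exact ge_of_tendsto t (Filter.eventually_of_mem self_mem_nhdsWithin fun c hc => h c hc)
  · intro h
    have h' : ∀ w, |v w| ≤ ((i : ℝ≥0) : ℝ) * ρ w := by simpa using h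
    exact (iInf₂_le (f := fun (C : ℝ≥0) (_ : ∀ w, |v w| ≤ C * ρ w) => (C : ℝ≥0∞)) (i : ℝ≥0)
      h').trans_eq (ENNReal.coe_natCast i)

/-- Banach–Alaoglu: the ball embeds as the linear functions in a product of compact intervals. -/
theorem isCompact_dualBall (ρ : Seminorm ℝ V) (i : ℕ) : IsCompact (dualBall ρ i) := by
  rw [isEmbedding_dual.isCompact_iff]
  have e : (fun (v : Module.Dual ℝ V) (w : V) => v w) '' dualBall ρ i =
      (Set.univ.pi fun w => Set.Icc (-(i • ρ) w) ((i • ρ) w)) ∩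
        Set.range ((↑) : (V →ₗ[ℝ] ℝ) → V → ℝ) := by
    ext φ
    simp only [Set.mem_image, mem_dualBall, Set.mem_inter_iff, Set.mem_pi, Set.mem_univ,
      forall_true_left, Set.mem_Icc, ← abs_le, Set.mem_range]
    constructor
    · rintro ⟨v, hv, rfl⟩
      exact ⟨hv, v, rfl⟩
    · rintro ⟨hv, v, rfl⟩
      exact ⟨v, hv, rfl⟩
  rw [e]
  exact (isCompact_univ_pi fun w => isCompact_Icc).inter_right
    (LinearMap.isClosed_range_coe V ℝ (RingHom.id ℝ))

theorem continuous_hat (f : Sym V) : Continuous (hat f) := by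
  unfold hat
  induction f using SymmetricAlgebra.induction with
  | algebraMap r =>
    simp only [AlgHom.commutes]
    exact continuous_const
  | ι w =>
    simp only [SymmetricAlgebra.lift_ι_apply]
    exact continuous_dual_apply w
  | mul a b ha hb =>
    simp only [map_mul]
    exact ha.mul hb
  | add a b ha hb =>
    simp only [map_add]
    exact ha.add hb

/-- The homomorphism `f ↦ f̂` into the continuous functions on a set of functionals. -/
def hatMap (K : Set (Module.Dual ℝ V)) : Sym V →ₐ[ℝ] C(K, ℝ) where
  toFun f := ⟨fun v => hat f v, (continuous_hat f).comp continuous_subtype_val⟩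
  map_one' := by ext; simp [hat]
  map_mul' f g := by ext; simp [hat]
  map_zero' := by ext; simp [hat]
  map_add' f g := by ext; simp [hat]
  commutes' r := by ext; simp [hat]

theorem hatMap_apply (K : Set (Module.Dual ℝ V)) (f : Sym V) (v : K) : hatMap K f v = hat f v :=
  rfl

/-- Stone–Weierstrass: the evaluations at vectors already separate functionals. -/
theorem dense_range_hatMap {K : Set (Module.Dual ℝ V)} (hK : IsCompact K) :
    Dense (Set.range (hatMap K)) := by
  have : CompactSpace K := isCompact_iff_compactSpace.1 hK
  have h := ContinuousMap.subalgebra_topologicalClosure_eq_top_of_separatesPoints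
    (hatMap K).range (by
      intro v v' hne
      obtain ⟨w, hw⟩ : ∃ w, (v : Module.Dual ℝ V) w ≠ (v' : Module.Dual ℝ V) w := by
        by_contra! hcon
        exact hne (Subtype.ext (LinearMap.ext hcon))
      refine ⟨hatMap K (SymmetricAlgebra.ι ℝ V w), ⟨_, ⟨_, rfl⟩, rfl⟩, ?_⟩
      simpa only [hatMap_apply, hat, SymmetricAlgebra.lift_ι_apply] using hw)
  intro F
  have h2 : F ∈ (hatMap K).range.topologicalClosure := by
    rw [h]
    exact Algebra.mem_top
  exact h2

theorem abs_hat_le {ρ : Seminorm ℝ V} {i : ℕ} {v : Module.Dual ℝ V} (hv : v ∈ dualBall ρ i)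
    (f : Sym V) : |hat f v| ≤ projectiveExtension (i • ρ) f := by
  have h := le_projectiveExtension (ρ := i • ρ) (C := 1)
    (p := (normSeminorm ℝ ℝ).comp (SymmetricAlgebra.lift v).toLinearMap) zero_le_one
    (fun k w => ?_) f
  · rw [one_mul] at h
    exact h
  · rw [one_mul, Seminorm.comp_apply, AlgHom.toLinearMap_apply, map_prod, coe_normSeminorm,
      norm_prod]
    refine Finset.prod_le_prod (fun j _ => norm_nonneg _) fun j _ => ?_
    rw [SymmetricAlgebra.lift_ι_apply]
    exact mem_dualBall.1 hv _

/-- The bounded characters of `S(V)` are the evaluations at the points of the ball. -/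
theorem exists_dualBall_of_algHom {ρ : Seminorm ℝ V} {i : ℕ} {χ : Sym V →ₐ[ℝ] ℝ}
    (hχ : ∀ f, |χ f| ≤ projectiveExtension (i • ρ) f) :
    ∃ v ∈ dualBall ρ i, ∀ f, χ f = hat f v := by
  refine ⟨χ.toLinearMap ∘ₗ SymmetricAlgebra.ι ℝ V, mem_dualBall.2 fun w => ?_, fun f => ?_⟩
  · rw [← projectiveExtension_ι]
    exact hχ _
  · rw [hat]
    congr 1
    apply SymmetricAlgebra.algHom_ext
    rw [SymmetricAlgebra.lift_comp_ι]
    rfl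

end Dual

/-! ### Existence, uniqueness and support of representing measures -/

section Moment

variable {V : Type*} [AddCommGroup V] [Module ℝ V]

/-- If `f̂ ≥ 0` on the ball, every bounded character is nonnegative at `f`, hence so is `L`. Thus
`L` has a representing measure on the ball, which is pushed forward to the dual. -/
theorem exists_represents {ρ : Seminorm ℝ V} {i m : ℕ} (hm : m ≠ 0) {L : Sym V →ₗ[ℝ] ℝ}
    (hL : ContinuousFor (projectiveExtension (V := V) (i • ρ)) L) (hpos : ∀ b, 0 ≤ L (b ^ m)) :
    ∃ μ : Measure (Module.Dual ℝ V),
      IsRadon μ ∧ SupportedBy μ (dualBall ρ i) ∧ Represents μ L := by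
  have hK := isCompact_dualBall ρ i
  have : CompactSpace (dualBall ρ i) := isCompact_iff_compactSpace.1 hK
  obtain ⟨ν, _, _, hν⟩ := exists_measure_of_nonneg (hatMap (dualBall ρ i)).toLinearMap 1
    (map_one (hatMap (dualBall ρ i))) L (fun f hf => by
      refine nonneg_of_forall_algHom (projectiveExtension_mul_le (i • ρ)) hm hL hpos
        fun χ hχ => ?_
      obtain ⟨v, hv, hχv⟩ := exists_dualBall_of_algHom hχ
      rw [hχv]
      exact hf ⟨v, hv⟩)
  have hR := isRadon_map_val hK ν
  have hs := supportedBy_map_val hK.measurableSet ν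
  refine ⟨_, hR, hs, fun f => ⟨hR.integrable hK hs (continuous_hat f), ?_⟩⟩
  rw [(MeasurableEmbedding.subtype_coe hK.measurableSet).integral_map]
  exact hν f

theorem eq_of_represents {μ μ' : Measure (Module.Dual ℝ V)} (hμ : IsRadon μ) (hμ' : IsRadon μ')
    {K : Set (Module.Dual ℝ V)} (hK : IsCompact K) (hs : SupportedBy μ K)
    (hs' : SupportedBy μ' K) {L : Sym V →ₗ[ℝ] ℝ} (h : Represents μ L) (h' : Represents μ' L) :
    μ = μ' := by
  have : CompactSpace K := isCompact_iff_compactSpace.1 hK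
  have he := MeasurableEmbedding.subtype_coe hK.measurableSet
  obtain ⟨ν, _, _, rfl⟩ := hμ.exists_eq_map_val hK hs
  obtain ⟨ν', _, _, rfl⟩ := hμ'.exists_eq_map_val hK hs'
  rw [measure_eq_of_dense (ν := ν) (ν' := ν') (dense_range_hatMap hK)]
  rintro _ ⟨f, rfl⟩
  have h1 := (h f).2.symm.trans (h' f).2
  rwa [he.integral_map, he.integral_map] at h1

/-- Directedness supplies one compact ball supporting both measures. -/
theorem IsDirectedFamily.eq_of_represents {S : Set (Seminorm ℝ V)} (hS : IsDirectedFamily S)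
    {μ μ' : Measure (Module.Dual ℝ V)} (hμ : μ ∈ Measures S) (hμ' : μ' ∈ Measures S)
    {L : Sym V →ₗ[ℝ] ℝ} (h : Represents μ L) (h' : Represents μ' L) : μ = μ' := by
  obtain ⟨hR, ρ, hρ, i, -, hs⟩ := hμ
  obtain ⟨hR', ρ', hρ', j, -, hs'⟩ := hμ'
  obtain ⟨r, -, k, -, hi, hj⟩ := hS.exists_nsmul_le hρ hρ' i j
  exact LMC.eq_of_represents hR hR' (isCompact_dualBall r k)
    (hs.mono fun v hv => mem_dualBall.2 fun w => (mem_dualBall.1 hv w).trans (hi w))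
    (hs'.mono fun v hv => mem_dualBall.2 fun w => (mem_dualBall.1 hv w).trans (hj w)) h h'

theorem Represents.eq {μ : Measure (Module.Dual ℝ V)} {L L' : Sym V →ₗ[ℝ] ℝ}
    (h : Represents μ L) (h' : Represents μ L') : L = L' :=
  LinearMap.ext fun f => (h f).2.trans (h' f).2.symm

theorem IsRadon.exists_represents {μ : Measure (Module.Dual ℝ V)} (hμ : IsRadon μ)
    {K : Set (Module.Dual ℝ V)} (hK : IsCompact K) (hs : SupportedBy μ K) :
    ∃ L, Represents μ L := by
  have hint : ∀ f : Sym V, Integrable (hat f) μ := fun f => hμ.integrable hK hs (continuous_hat f)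
  refine ⟨
    { toFun := fun f => ∫ v, hat f v ∂μ
      map_add' := fun f g => ?_
      map_smul' := fun r f => ?_ }, fun f => ⟨hint f, rfl⟩⟩
  · rw [← integral_add (hint f) (hint g)]
    simp [hat]
  · rw [RingHom.id_apply, smul_eq_mul, ← integral_const_mul]
    simp [hat]

theorem Represents.positiveOn_sumsOfPowers {μ : Measure (Module.Dual ℝ V)} {L : Sym V →ₗ[ℝ] ℝ}
    (h : Represents μ L) (d : ℕ) : PositiveOn L (sumsOfPowers (Sym V) d) := by
  intro f hf
  induction hf using AddSubmonoid.closure_induction with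
  | mem x hx =>
    obtain ⟨a, rfl⟩ := hx
    rw [(h _).2]
    refine integral_nonneg fun v => ?_
    simp only [hat, map_pow]
    exact (even_two_mul d).pow_nonneg _
  | zero => simp
  | add x y _ _ hx hy =>
    rw [map_add]
    exact add_nonneg hx hy

/-- On the ball `f̂` is bounded by the projective extension, so the total mass, finite by
compactness, is a continuity constant. -/
theorem Represents.continuousFor {μ : Measure (Module.Dual ℝ V)} (hμ : IsRadon μ)
    {L : Sym V →ₗ[ℝ] ℝ} (h : Represents μ L) {ρ : Seminorm ℝ V} {i : ℕ}
    (hs : SupportedBy μ (dualBall ρ i)) :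
    ContinuousFor (projectiveExtension (V := V) (i • ρ)) L := by
  obtain ⟨ν, _, -, hν⟩ := hμ.exists_eq_map_val (isCompact_dualBall ρ i) hs
  have hfin : IsFiniteMeasure μ := by
    rw [hν]
    infer_instance
  refine ⟨μ.real Set.univ, fun f => ?_⟩
  rw [(h f).2, mul_comm]
  refine norm_integral_le_of_norm_le_const (μ := μ) (f := hat f) ?_
  have hs' : ∀ᵐ v ∂μ, v ∈ dualBall ρ i := hs
  filter_upwards [hs'] with v hv using abs_hat_le hv f

theorem Represents.positiveOn_iff {μ : Measure (Module.Dual ℝ V)} (hμ : IsRadon μ)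
    {L : Sym V →ₗ[ℝ] ℝ} (h : Represents μ L) {d : ℕ} (hd : 1 ≤ d) {M : Set (Sym V)}
    (hM : IsPowerModule d M) {ρ : Seminorm ℝ V} {i : ℕ} (hs : SupportedBy μ (dualBall ρ i)) :
    PositiveOn L M ↔ SupportedBy μ (positiveBall M ρ i) := by
  constructor
  · intro hL
    have hK := isCompact_dualBall ρ i
    have : CompactSpace (dualBall ρ i) := isCompact_iff_compactSpace.1 hK
    have he := MeasurableEmbedding.subtype_coe hK.measurableSet
    -- The elements `a ^ (2 * d) * g` stay in `M`, and the functions `â` are dense on the ball.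
    have hneg : ∀ g : M, μ {v | hat g.1 v < 0} = 0 := by
      rintro ⟨g, hg⟩
      obtain ⟨ν, _, _, rfl⟩ := hμ.exists_eq_map_val hK hs
      rw [he.map_apply]
      refine measure_neg_eq_zero_of_dense ν (m := 2 * d) (by omega) (dense_range_hatMap hK)
        (hatMap _ g) ?_
      rintro _ ⟨a, rfl⟩
      have h1 := hL _ (hM.pow_mul_mem a g hg)
      rw [(h _).2, he.integral_map] at h1
      rw [← map_pow, ← map_mul]
      exact h1
    have hU := hμ.measure_iUnion_eq_zero
      (fun g : M => isOpen_lt (continuous_hat g.1) continuous_const) hneg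
    refine measure_mono_null (fun v hv => ?_) (measure_union_null hs hU)
    by_contra hcon
    rw [Set.mem_union, not_or, Set.notMem_compl_iff] at hcon
    refine hv ⟨hcon.1, fun g hg => ?_⟩
    by_contra! hlt
    exact hcon.2 (Set.mem_iUnion.2 ⟨⟨g, hg⟩, hlt⟩)
  · intro hsup f hf
    rw [(h f).2]
    have hs' : ∀ᵐ v ∂μ, v ∈ positiveBall M ρ i := hsup
    refine integral_nonneg_of_ae ?_
    filter_upwards [hs'] with v hv using hv.2 f hf

theorem pow_nonneg_of_mem_functionals {S : Set (Seminorm ℝ V)} {d : ℕ} {L : Sym V →ₗ[ℝ] ℝ}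
    (hL : L ∈ Functionals S d) (b : Sym V) : 0 ≤ L (b ^ (2 * d)) :=
  hL.2 _ (AddSubmonoid.subset_closure ⟨b, rfl⟩)

theorem IsDirectedFamily.exists_measure {S : Set (Seminorm ℝ V)} (hS : IsDirectedFamily S) {d : ℕ}
    (hd : 1 ≤ d) {L : Sym V →ₗ[ℝ] ℝ} (hL : L ∈ Functionals S d) :
    ∃ μ ∈ Measures S, Represents μ L := by
  obtain ⟨_, ⟨ρ, hρ, i, hi, rfl⟩, hc⟩ := hS.extensionFamily.exists_continuousFor hL.1
  obtain ⟨μ, hμ, hs, hr⟩ := LMC.exists_represents (m := 2 * d) (by omega) hc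
    (pow_nonneg_of_mem_functionals hL)
  exact ⟨μ, ⟨hμ, ρ, hρ, i, hi, hs⟩, hr⟩

theorem exists_functional {S : Set (Seminorm ℝ V)} (d : ℕ) {μ : Measure (Module.Dual ℝ V)}
    (hμ : μ ∈ Measures S) : ∃ L ∈ Functionals S d, Represents μ L := by
  obtain ⟨hR, ρ, hρ, i, hi, hs⟩ := hμ
  obtain ⟨L, hL⟩ := hR.exists_represents (isCompact_dualBall ρ i) hs
  exact ⟨L, ⟨continuous_of_continuousFor (P := extensionFamily (V := V) S) ⟨ρ, hρ, i, hi, rfl⟩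
    (hL.continuousFor hR hs), hL.positiveOn_sumsOfPowers d⟩, hL⟩

/-- Continuity yields a representing measure on this particular ball, and uniqueness identifies it
with `μ`. -/
theorem IsDirectedFamily.continuousFor_iff {S : Set (Seminorm ℝ V)} (hS : IsDirectedFamily S)
    {d : ℕ} (hd : 1 ≤ d) {L : Sym V →ₗ[ℝ] ℝ} (hL : L ∈ Functionals S d)
    {μ : Measure (Module.Dual ℝ V)} (hμ : μ ∈ Measures S) (h : Represents μ L)
    {ρ : Seminorm ℝ V} (hρ : ρ ∈ S) {i : ℕ} (hi : 1 ≤ i) :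
    ContinuousFor (projectiveExtension (V := V) (i • ρ)) L ↔ SupportedBy μ (dualBall ρ i) := by
  refine ⟨fun hc => ?_, h.continuousFor hμ.1⟩
  obtain ⟨μ', hμ', hs, hr⟩ := LMC.exists_represents (m := 2 * d) (by omega) hc
    (pow_nonneg_of_mem_functionals hL)
  rwa [hS.eq_of_represents hμ ⟨hμ', ρ, hρ, i, hi, hs⟩ h hr]

/-- The correspondence between functionals and measures. -/
theorem IsDirectedFamily.exists_equiv {S : Set (Seminorm ℝ V)} (hS : IsDirectedFamily S) {d : ℕ}
    (hd : 1 ≤ d) :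
    ∃ Φ : Functionals S d ≃ Measures S, ∀ L μ, Φ L = μ ↔ Represents μ.1 L.1 := by
  choose φ hφ hφr using fun L : Functionals S d => hS.exists_measure hd L.2
  let Ψ : Functionals S d → Measures S := fun L => ⟨φ L, hφ L⟩
  have hΨ : Function.Bijective Ψ := by
    constructor
    · intro L L' h
      have h1 := hφr L
      rw [show φ L = φ L' from congrArg Subtype.val h] at h1
      exact Subtype.ext (h1.eq (hφr L'))
    · rintro ⟨μ, hμ⟩
      obtain ⟨L, hL, hr⟩ := exists_functional d hμ
      exact ⟨⟨L, hL⟩, Subtype.ext (hS.eq_of_represents (hφ _) hμ (hφr _) hr)⟩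
  refine ⟨Equiv.ofBijective Ψ hΨ, fun L μ => ?_⟩
  constructor
  · rintro rfl
    exact hφr L
  · intro h
    exact Subtype.ext (hS.eq_of_represents (hφ L) μ.2 (hφr L) h)

end Moment

end LMC

end

theorem corollary5p2 {V : Type*} [AddCommGroup V] [Module ℝ V] (S : Set (Seminorm ℝ V))
    (hS : LMC.IsDirectedFamily S) :
    LMC.IsFinestLMCExtension (LMC.seminormTopology S) (LMC.extensionTopology S) ∧
    ∀ d : ℕ, 1 ≤ d →
      ∃ Φ : LMC.Functionals S d ≃ LMC.Measures S,
        (∀ L μ, Φ L = μ ↔ LMC.Represents μ.1 L.1) ∧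
        (∀ L, ∀ ρ ∈ S, ∀ i : ℕ, 1 ≤ i →
          (LMC.ContinuousFor (LMC.projectiveExtension (V := V) (i • ρ)) L.1 ↔
            LMC.SupportedBy (Φ L).1 (LMC.dualBall ρ i))) ∧
        (∀ M : Set (LMC.Sym V), LMC.IsPowerModule d M →
          ∀ L, ∀ ρ ∈ S, ∀ i : ℕ, 1 ≤ i → LMC.SupportedBy (Φ L).1 (LMC.dualBall ρ i) →
            (LMC.PositiveOn L.1 M ↔
              LMC.SupportedBy (Φ L).1 (LMC.positiveBall M ρ i))) := by
  refine ⟨LMC.isFinestLMCExtension_extensionTopology hS, fun d hd => ?_⟩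
  obtain ⟨Φ, hΦ⟩ := hS.exists_equiv hd
  have hr : ∀ L, LMC.Represents (Φ L).1 L.1 := fun L => (hΦ L _).1 rfl
  exact ⟨Φ, hΦ,
    fun L ρ hρ i hi => hS.continuousFor_iff hd L.2 (Φ L).2 (hr L) hρ hi,
    fun M hM L ρ _ i _ hs => (hr L).positiveOn_iff (Φ L).2.1 hd hM hs⟩
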